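/- Let $r\in\mathbb N$. For $h=1,\dots,r$ let $G_h=(\mathcal S_h,E_h)$ be a finite connected graph with $N_h=|\mathcal S_h|$ vertices and let $\mu_h$ be a probability distribution on $\mathcal S_h$ such that $\mu_h(s)=0$ for at least one $s\in\mathcal S_h$ (this holds in particular when the subgraph of $G_h$ induced by the support of $\mu_h$ is not connected). For $k\ge 1$ let $\mathcal A_{h,k}=\{s\in\mathcal S_h:\mu_h(s)<1/k\}$, let $\eta_{h,k}$ be the uniform distribution on $\mathcal A_{h,k}$ and put $(\mu_h)_k=\frac1k\eta_{h,k}+\frac{k-1}{k}\mu_h$. Fix a labelling $\mathcal S_h=\{s^1,\dots,s^{N_h}\}$ with $\mu_h(s^1)\ge\dots\ge\mu_h(s^{N_h})$. With $w=(\mu_h)_k$ set $$R_l=\sum_{m>l}\mathbf 1_{\{\{s^l,s^m\}\in E_h\}}+\sum_{m<l}\frac{w(s^m)}{w(s^l)}\mathbf 1_{\{\{s^l,s^m\}\in E_h\}},\qquad p=\min_{l}\frac1{2R_l},$$ and let $P^{((\mu_h)_k,G_h)}$ be the matrix on $\mathcal S_h$ with entries $p_{l,l}=1-pR_l$; $p_{l,m}=p$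 if $l<m$ and $\{s^l,s^m\}\in E_h$; $p_{l,m}=\frac{w(s^m)}{w(s^l)}\,p$ if $l>m$ and $\{s^l,s^m\}\in E_h$; and $p_{l,m}=0$ otherwise. Let $c>0$ and, for each $h$, let $(t^{(h)}_\ell)_{\ell\ge1}$ be an increasing sequence of times in $\mathbb N=\{0,1,2,\dots\}$ with $t^{(h)}_{\ell+1}-t^{(h)}_\ell\ge c\,\ell^{5N_h-1}$ for all $\ell\ge1$. Let $X_1,\dots,X_r$ be independent non-homogeneous Markov chains $X_h=(X_h(t):t\in\mathbb N)$ on $\mathcal S_h$ with arbitrary initial distributions. Suppose that for some index $k_h\ge1$ the transition matrix $P_h(t)$ of $X_h$ from time $t$ to time $t+1$ is $P^{((\mu_h)_k,G_h)}$ whenever $t\in[t^{(h)}_k,t^{(h)}_{k+1})$ and $k\ge k_h$; at the finitely many times $t<t^{(h)}_{k_h}$ the stochastic matrix $P_h(t)$ is arbitrary. Let $X(t)=(X_1(t),\dots,X_r(t))$ on $\mathcal S=\prod_h\mathcal S_h$ and $\mu(s)=\prod_{h}\mu_h(s_h)$. Then, almost surely, for each $s=(s_1,\dots,s_r)\in\mathcal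 S$, $$\lim_{t\to\infty}\frac1t\sum_{m=0}^{t-1}\mathbf 1_{\{X(m)=s\}}=\lim_{t\to\infty}\frac1t\sum_{m=0}^{t-1}\prod_{h=1}^r\mathbf 1_{\{X_h(m)=s_h\}}=\prod_{h=1}^r\mu_h(s_h)=\mu(s).$$ Moreover, if at the times $t<t^{(h)}_{k_h}$ the matrices $P_h(t)$ also give zero probability to moves between distinct vertices that are not joined by an edge of $G_h$, then $X$ is consistent with the strong product $G=G_1\boxtimes\cdots\boxtimes G_r$: for each $t$, almost surely $X(t)$ and $X(t+1)$ are equal or joined by an edge of $G$. (Two distinct tuples are joined in $G$ when, in each coordinate, their entries are equal or joined by an edge.) -/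

import Mathlib

open Filter Topology MeasureTheory ProbabilityTheory Finset

namespace GraphChain

/-- The strong product `G₁ ⊠ ⋯ ⊠ G_r`: two distinct tuples are joined by an edge when in each
coordinate the entries are equal or joined by an edge. -/
def strongProduct {ι : Type*} {S : ι → Type*} (G : ∀ h, SimpleGraph (S h)) :
    SimpleGraph (∀ h, S h) where
  Adj s t := s ≠ t ∧ ∀ h, s h = t h ∨ (G h).Adj (s h) (t h)
  symm := ⟨fun _ _ hst => ⟨hst.1.symm, fun h => (hst.2 h).imp Eq.symm fun a => a.symm⟩⟩
  loopless := ⟨fun _ hs => hs.1 rfl⟩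

section OneFactor

variable {S : Type*} [Fintype S]

open Classical in
/-- The set `A_k = {s : μ(s) < 1/k}`. -/
noncomputable def lowSet (μ : S → ℝ) (k : ℕ) : Finset S :=
  Finset.univ.filter fun s => μ s < 1 / (k : ℝ)

open Classical in
/-- `η_k`, the uniform distribution on `A_k`. -/
noncomputable def lowUniform (μ : S → ℝ) (k : ℕ) (s : S) : ℝ :=
  1 / ((lowSet μ k).card : ℝ) * (if s ∈ lowSet μ k then 1 else 0)

/-- `μ_k = (1/k) η_k + ((k-1)/k) μ`. -/
noncomputable def perturbed (μ : S → ℝ) (k : ℕ) (s : S) : ℝ :=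
  1 / (k : ℝ) * lowUniform μ k s + ((k : ℝ) - 1) / (k : ℝ) * μ s

/-- A labelling `s¹, …, s^N` of the states along which `μ` is non-increasing. -/
def IsLabelling (μ : S → ℝ) (e : S ≃ Fin (Fintype.card S)) : Prop :=
  ∀ s t, e s ≤ e t → μ t ≤ μ s

open Classical in
/-- For the state `s` with label `l`: the number of neighbours with label `> l`, plus the sum of
`w(s') / w(s)` over the neighbours `s'` with label `< l`. -/
noncomputable def rowWeight (w : S → ℝ) (G : SimpleGraph S) (e : S ≃ Fin (Fintype.card S))
    (s : S) : ℝ :=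
  (∑ s' : S, if e s < e s' ∧ G.Adj s s' then 1 else 0) +
    ∑ s' : S, if e s' < e s ∧ G.Adj s s' then w s' / w s else 0

/-- The number `p = min_s 1 / (2 * rowWeight s)`. -/
noncomputable def stepProb (w : S → ℝ) (G : SimpleGraph S) (e : S ≃ Fin (Fintype.card S)) : ℝ :=
  ⨅ s : S, 1 / (2 * rowWeight w G e s)

open Classical in
/-- The transition matrix `P^{(w, G)}`. -/
noncomputable def transMatrix (w : S → ℝ) (G : SimpleGraph S) (e : S ≃ Fin (Fintype.card S)) :
    Matrix S S ℝ := fun s s' =>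
  if s = s' then 1 - stepProb w G e * rowWeight w G e s
  else if G.Adj s s' then
    if e s < e s' then stepProb w G e else w s' / w s * stepProb w G e
  else 0

end OneFactor

/-- `X` is a (not necessarily homogeneous) Markov chain with initial distribution `init` and
transition matrix `Q t` from time `t` to time `t + 1`. -/
structure IsMarkovChain {Ω S : Type*} [MeasurableSpace Ω] [Fintype S] [MeasurableSpace S]
    (P : Measure Ω) (init : S → ℝ) (Q : ℕ → Matrix S S ℝ) (X : ℕ → Ω → S) : Prop where
  init_mem : init ∈ stdSimplex ℝ S
  stochastic : ∀ t s, Q t s ∈ stdSimplex ℝ S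
  measurable : ∀ t, Measurable (X t)
  law : ∀ (n : ℕ) (x : ℕ → S), P.real {ω | ∀ t ≤ n, X t ω = x t} =
    init (x 0) * ∏ t ∈ Finset.range n, Q t (x t) (x (t + 1))

/-- A process is consistent with a graph when, for each time `t`, its positions at times `t` and
`t + 1` are almost surely adjacent, where a vertex counts as adjacent to itself. -/
def IsConsistent {Ω S : Type*} [MeasurableSpace Ω] (P : Measure Ω) (G : SimpleGraph S)
    (X : ℕ → Ω → S) : Prop :=
  ∀ t, ∀ᵐ ω ∂P, X t ω = X (t + 1) ω ∨ G.Adj (X t ω) (X (t + 1) ω)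

/-- The product process `X(t) = (X_1(t), …, X_r(t))`. -/
def productProcess {ι Ω : Type*} {S : ι → Type*} (X : ∀ h, ℕ → Ω → S h) :
    ℕ → Ω → ∀ h, S h :=
  fun t ω h => X h t ω

end GraphChain

/-! In block `k` a factor is reversible with respect to `μ_k`, whose masses are at least `1/(kN)`.
Staying put and crossing an edge then have probability at least `α/k²` with `α = 1/(4N³)`. As the
graph is connected, all `N`-step transition probabilities are at least `(α/k²)^N`, and `N` steps
contract zero-sum vectors by `1 - (α/k²)^N` in `ℓ¹` (`sum_abs_vecMul_le_of_le`). Mixing in block `k`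
thus takes about `k^(2N)` steps, fewer than the `c k^(5N-1)` available; since `μ_k → μ`, the
marginal laws tend to `μ` (`tendsto_law`).

For almost sure averages, the gaps force the block index `K` before time `n^5` to satisfy `K^N =
O(n)`, so correlations up to that time sum over lags to `O(n²)` (`exists_correlation_bound`). The
variance of the occupation count is then `O(n^7)`, which is summable after division by `n^10`.
Averages converge along `n^5`, and monotonicity of the counts fills the gaps (`ae_tendsto_average`).

By independence, probabilities for the product multiply, and its covariances are at most the sum of
those of the factors. Hence the averaging argument runs on the product directly
(`ae_tendsto_average_prod`), with no mixing estimate for the product chain. -/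

namespace GraphChain

/-! ### Products of stochastic matrices and their contraction. -/

section Products

variable {S : Type*} [Fintype S]

open Classical in
/-- The transition matrix `Q m * ⋯ * Q (m + j - 1)` from time `m` to time `m + j`. -/
noncomputable def transProd (Q : ℕ → Matrix S S ℝ) : ℕ → ℕ → Matrix S S ℝ
  | _, 0 => 1
  | m, j + 1 => Q m * transProd Q (m + 1) j

lemma transProd_succ (Q : ℕ → Matrix S S ℝ) (m j : ℕ) :
    transProd Q m (j + 1) = Q m * transProd Q (m + 1) j := rfl

lemma transProd_add (Q : ℕ → Matrix S S ℝ) (m i j : ℕ) :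
    transProd Q m (i + j) = transProd Q m i * transProd Q (m + i) j := by
  classical
  induction i generalizing m with
  | zero => simp [transProd]
  | succ i ih =>
    rw [show i + 1 + j = (i + j) + 1 by ring, transProd_succ, ih, transProd_succ, Matrix.mul_assoc,
      show m + (i + 1) = m + 1 + i by ring]

lemma transProd_mem_stdSimplex {Q : ℕ → Matrix S S ℝ} (hQ : ∀ t s, Q t s ∈ stdSimplex ℝ S)
    (m j : ℕ) (s : S) : transProd Q m j s ∈ stdSimplex ℝ S := by
  classical
  induction j generalizing m s with
  | zero =>
    refine ⟨fun x => ?_, ?_⟩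
    · simp only [transProd, Matrix.one_apply]
      split_ifs <;> norm_num
    · simp [transProd, Matrix.one_apply]
  | succ j ih =>
    refine ⟨fun x => ?_, ?_⟩
    · rw [transProd_succ, Matrix.mul_apply]
      exact Finset.sum_nonneg fun z _ => mul_nonneg ((hQ m s).1 z) ((ih (m + 1) z).1 x)
    · simp only [transProd_succ, Matrix.mul_apply]
      rw [Finset.sum_comm]
      simp only [← Finset.mul_sum, (ih (m + 1) _).2, mul_one, (hQ m s).2]

lemma sum_vecMul_of_stochastic {M : Matrix S S ℝ} (hM : ∀ s, M s ∈ stdSimplex ℝ S) (v : S → ℝ) :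
    ∑ s, Matrix.vecMul v M s = ∑ s, v s := by
  simp only [Matrix.vecMul, dotProduct]
  rw [Finset.sum_comm]
  simp only [← Finset.mul_sum, (hM _).2, mul_one]

lemma sum_abs_vecMul_le {M : Matrix S S ℝ} (hM : ∀ s, M s ∈ stdSimplex ℝ S) (v : S → ℝ) :
    ∑ s, |Matrix.vecMul v M s| ≤ ∑ s, |v s| := by
  calc ∑ s, |Matrix.vecMul v M s| ≤ ∑ s, ∑ x, |v x| * M x s := by
        refine Finset.sum_le_sum fun s _ => ?_
        refine (Finset.abs_sum_le_sum_abs _ _).trans (Finset.sum_le_sum fun x _ => ?_)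
        rw [abs_mul, abs_of_nonneg ((hM x).1 s)]
    _ = ∑ s, |v s| := by
        rw [Finset.sum_comm]
        simp only [← Finset.mul_sum, (hM _).2, mul_one]

/-- Doeblin's contraction: a stochastic matrix with entries at least `ε` contracts the `ℓ¹` norm
of zero-sum vectors by `1 - ε`. -/
lemma sum_abs_vecMul_le_of_le [Nonempty S] {M : Matrix S S ℝ} (hM : ∀ s, M s ∈ stdSimplex ℝ S)
    {ε : ℝ} (hε : 0 ≤ ε) (hMε : ∀ s s', ε ≤ M s s') {v : S → ℝ} (hv : ∑ s, v s = 0) :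
    ∑ s, |Matrix.vecMul v M s| ≤ (1 - ε) * ∑ s, |v s| := by
  calc ∑ s, |Matrix.vecMul v M s| ≤ ∑ s, ∑ x, |v x| * (M x s - ε) := by
        refine Finset.sum_le_sum fun s _ => ?_
        -- Removing the constant `ε` from a column costs nothing since `v` sums to zero, and it
        -- leaves nonnegative entries with row sums `1 - |S| ε`.
        have h : Matrix.vecMul v M s = ∑ x, v x * (M x s - ε) := by
          simp only [mul_sub, Finset.sum_sub_distrib, ← Finset.sum_mul, hv, zero_mul, sub_zero]
          rfl
        rw [h]
        refine (Finset.abs_sum_le_sum_abs _ _).trans (Finset.sum_le_sum fun x _ => ?_)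
        rw [abs_mul, abs_of_nonneg (sub_nonneg.2 (hMε x s))]
    _ = (1 - Fintype.card S * ε) * ∑ s, |v s| := by
        rw [Finset.sum_comm]
        simp only [← Finset.mul_sum, Finset.sum_sub_distrib, (hM _).2, Finset.sum_const,
          Finset.card_univ, nsmul_eq_mul, ← Finset.sum_mul]
        ring
    _ ≤ (1 - ε) * ∑ s, |v s| := by
        have h1 : (1 : ℝ) ≤ Fintype.card S := by exact_mod_cast Fintype.card_pos
        have h2 : 0 ≤ ∑ s, |v s| := Finset.sum_nonneg fun _ _ => abs_nonneg _
        gcongr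
        nlinarith

/-- Each of the `j / N` disjoint windows of length `N` contracts; the `j % N` leftover steps merely
do not expand. Only windows inside `[a, b]` need the lower bound, so `ε` may depend on the horizon
`b`. -/
lemma sum_abs_vecMul_transProd_le [Nonempty S] {Q : ℕ → Matrix S S ℝ}
    (hQ : ∀ t s, Q t s ∈ stdSimplex ℝ S) {ε : ℝ} (hε : 0 ≤ ε) (hε1 : ε ≤ 1) {N a b : ℕ}
    (hlow : ∀ m, a ≤ m → m + N ≤ b → ∀ s s', ε ≤ transProd Q m N s s')
    {m j : ℕ} (hm : a ≤ m) (hj : m + j ≤ b) {v : S → ℝ} (hv : ∑ s, v s = 0) :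
    ∑ s, |Matrix.vecMul v (transProd Q m j) s| ≤ (1 - ε) ^ (j / N) * ∑ s, |v s| := by
  suffices H : ∀ q m, a ≤ m → m + N * q ≤ b → ∀ v : S → ℝ, ∑ s, v s = 0 →
      ∑ s, |Matrix.vecMul v (transProd Q m (N * q)) s| ≤ (1 - ε) ^ q * ∑ s, |v s| by
    have hdm := Nat.div_add_mod j N
    have h1 := H (j / N) m hm (by omega) v hv
    calc _ = ∑ s, |Matrix.vecMul (Matrix.vecMul v (transProd Q m (N * (j / N))))
          (transProd Q (m + N * (j / N)) (j % N)) s| := by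
            rw [Matrix.vecMul_vecMul, ← transProd_add, hdm]
      _ ≤ _ := (sum_abs_vecMul_le (transProd_mem_stdSimplex hQ _ _) _).trans h1
  intro q
  induction q with
  | zero =>
    intro m _ _ v _
    simp [transProd]
  | succ q ih =>
    intro m hm hb v hv
    rw [Nat.mul_succ, add_comm, transProd_add, ← Matrix.vecMul_vecMul]
    have hb' : m + N + N * q ≤ b := by rw [Nat.mul_succ] at hb; omega
    have h1 := ih (m + N) (by omega) hb' (Matrix.vecMul v (transProd Q m N))
      (by rw [sum_vecMul_of_stochastic (transProd_mem_stdSimplex hQ _ _), hv])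
    refine h1.trans ?_
    rw [pow_succ, mul_assoc]
    exact mul_le_mul_of_nonneg_left (sum_abs_vecMul_le_of_le (transProd_mem_stdSimplex hQ _ _) hε
      (hlow m hm (by omega)) hv) (pow_nonneg (by linarith) _)

/-- Follow the walk and then wait at its endpoint: this single trajectory already has weight at
least `a ^ j`. -/
lemma pow_le_transProd_of_walk {Q : ℕ → Matrix S S ℝ} (hQ : ∀ t s, Q t s ∈ stdSimplex ℝ S)
    {G : SimpleGraph S} {a : ℝ} (ha : 0 ≤ a) (j : ℕ) : ∀ (m : ℕ),
    (∀ t, m ≤ t → t < m + j → ∀ s s', (s = s' ∨ G.Adj s s') → a ≤ Q t s s') →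
    ∀ (s s' : S) (p : G.Walk s s'), p.length ≤ j → a ^ j ≤ transProd Q m j s s' := by
  classical
  induction j with
  | zero =>
    intro m _ s s' p hp
    cases p with
    | nil => simp [transProd]
    | cons _ _ => simp at hp
  | succ j ih =>
    intro m hlow s s' p hp
    obtain ⟨u, hu, q, hq⟩ : ∃ u, (s = u ∨ G.Adj s u) ∧ ∃ q : G.Walk u s', q.length ≤ j := by
      cases p with
      | nil => exact ⟨s, Or.inl rfl, SimpleGraph.Walk.nil, by simp⟩
      | cons h q => exact ⟨_, Or.inr h, q, by simpa using hp⟩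
    have h1 := hlow m le_rfl (by omega) s u hu
    have h2 := ih (m + 1) (fun t ht ht' => hlow t (by omega) (by omega)) u s' q hq
    rw [transProd_succ, Matrix.mul_apply, pow_succ']
    calc a * a ^ j ≤ Q m s u * transProd Q (m + 1) j u s' :=
          mul_le_mul h1 h2 (pow_nonneg ha _) ((hQ m s).1 u)
      _ ≤ _ := Finset.single_le_sum (f := fun u => Q m s u * transProd Q (m + 1) j u s')
          (fun z _ => mul_nonneg ((hQ m s).1 z) ((transProd_mem_stdSimplex hQ _ _ z).1 s'))
          (Finset.mem_univ u)

lemma pow_card_le_transProd {Q : ℕ → Matrix S S ℝ} (hQ : ∀ t s, Q t s ∈ stdSimplex ℝ S)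
    {G : SimpleGraph S} (hG : G.Connected) {a : ℝ} (ha : 0 ≤ a) {m : ℕ}
    (hlow : ∀ t, m ≤ t → t < m + Fintype.card S → ∀ s s', (s = s' ∨ G.Adj s s') → a ≤ Q t s s')
    (s s' : S) : a ^ Fintype.card S ≤ transProd Q m (Fintype.card S) s s' := by
  obtain ⟨p, hp⟩ := (hG s s').exists_isPath
  exact pow_le_transProd_of_walk hQ ha _ m hlow s s' p hp.length_lt.le

lemma vecMul_transProd_eq_self {Q : ℕ → Matrix S S ℝ} {w : S → ℝ} {m j : ℕ}
    (h : ∀ t, m ≤ t → t < m + j → Matrix.vecMul w (Q t) = w) :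
    Matrix.vecMul w (transProd Q m j) = w := by
  classical
  induction j generalizing m with
  | zero => simp [transProd]
  | succ j ih =>
    rw [transProd_succ, ← Matrix.vecMul_vecMul, h m le_rfl (by omega)]
    exact ih fun t ht ht' => h t (by omega) (by omega)

end Products

/-! ### The perturbed distributions `μ_k`. -/

section Perturbed

variable {S : Type*} [Fintype S] {μ : S → ℝ} {k : ℕ}

/-- The zero of `μ` lies in every `A_k`; without it `η_k` could fail to be a distribution. -/
lemma lowSet_nonempty (hz : ∃ s, μ s = 0) (hk : 1 ≤ k) : (lowSet μ k).Nonempty := by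
  obtain ⟨s, hs⟩ := hz
  refine ⟨s, ?_⟩
  have : (0 : ℝ) < k := by exact_mod_cast hk
  simp only [lowSet, Finset.mem_filter, Finset.mem_univ, true_and, hs]
  positivity

lemma lowUniform_mem_stdSimplex (hz : ∃ s, μ s = 0) (hk : 1 ≤ k) :
    lowUniform μ k ∈ stdSimplex ℝ S := by
  classical
  refine ⟨fun s => ?_, ?_⟩
  · unfold lowUniform
    split_ifs <;> positivity
  · have : ((lowSet μ k).card : ℝ) ≠ 0 := by
      exact_mod_cast (Finset.card_pos.2 (lowSet_nonempty hz hk)).ne'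
    simp only [lowUniform, ← Finset.mul_sum]
    rw [Finset.sum_ite_mem]
    simp [this]

lemma perturbed_mem_stdSimplex (hμ : μ ∈ stdSimplex ℝ S) (hz : ∃ s, μ s = 0) (hk : 1 ≤ k) :
    perturbed μ k ∈ stdSimplex ℝ S := by
  have hk' : (1 : ℝ) ≤ k := by exact_mod_cast hk
  have h := lowUniform_mem_stdSimplex hz hk
  refine ⟨fun s => ?_, ?_⟩
  · exact add_nonneg (mul_nonneg (by positivity) (h.1 s))
      (mul_nonneg (div_nonneg (by linarith) (by linarith)) (hμ.1 s))
  · simp only [perturbed, Finset.sum_add_distrib, ← Finset.mul_sum, h.2, hμ.2]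
    field_simp
    ring

lemma le_one_of_mem_stdSimplex {v : S → ℝ} (hv : v ∈ stdSimplex ℝ S) (s : S) : v s ≤ 1 := by
  rw [← hv.2]
  exact Finset.single_le_sum (fun x _ => hv.1 x) (Finset.mem_univ s)

lemma abs_perturbed_sub_le (hμ : μ ∈ stdSimplex ℝ S) (hz : ∃ s, μ s = 0) (hk : 1 ≤ k) (s : S) :
    |perturbed μ k s - μ s| ≤ 1 / (k : ℝ) := by
  have hk' : (1 : ℝ) ≤ k := by exact_mod_cast hk
  have h := lowUniform_mem_stdSimplex hz hk
  have e : perturbed μ k s - μ s = 1 / (k : ℝ) * (lowUniform μ k s - μ s) := by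
    unfold perturbed
    field_simp
    ring
  rw [e, abs_mul, abs_of_nonneg (by positivity : (0 : ℝ) ≤ 1 / k)]
  refine mul_le_of_le_one_right (by positivity) ?_
  have := h.1 s
  have := hμ.1 s
  have := le_one_of_mem_stdSimplex h s
  have := le_one_of_mem_stdSimplex hμ s
  rw [abs_le]
  constructor <;> linarith

lemma one_lt_card_of_exists_eq_zero (hμ : μ ∈ stdSimplex ℝ S) (hz : ∃ s, μ s = 0) :
    1 < Fintype.card S := by
  obtain ⟨s, hs⟩ := hz
  by_contra h
  have : Subsingleton S := Fintype.card_le_one_iff_subsingleton.1 (by omega)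
  have h1 := hμ.2
  rw [Fintype.sum_eq_zero _ fun x => by rw [Subsingleton.elim x s, hs]] at h1
  norm_num at h1

/-- One summand suffices at each state: on `A_k` the uniform part gives `(1/k)(1/|S|)`; off it `μ ≥
1/k` with weight `(k-1)/k ≥ 1/2 ≥ 1/|S|`. The weight bound is where `k ≥ 2` enters. -/
lemma one_div_le_perturbed (hμ : μ ∈ stdSimplex ℝ S) (hz : ∃ s, μ s = 0) (hk : 2 ≤ k) (s : S) :
    1 / ((k : ℝ) * Fintype.card S) ≤ perturbed μ k s := by
  classical
  have hk' : (2 : ℝ) ≤ k := by exact_mod_cast hk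
  have hN : (2 : ℝ) ≤ Fintype.card S := by
    exact_mod_cast one_lt_card_of_exists_eq_zero hμ hz
  have h := lowUniform_mem_stdSimplex hz (by omega : 1 ≤ k)
  by_cases hs : s ∈ lowSet μ k
  · have h1 : 1 / (Fintype.card S : ℝ) ≤ lowUniform μ k s := by
      have h0 : (0 : ℝ) < (lowSet μ k).card := by exact_mod_cast Finset.card_pos.2 ⟨s, hs⟩
      have h2 : ((lowSet μ k).card : ℝ) ≤ Fintype.card S := by
        exact_mod_cast Finset.card_le_univ _
      simp only [lowUniform, if_pos hs, mul_one]
      exact one_div_le_one_div_of_le h0 h2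
    calc 1 / ((k : ℝ) * Fintype.card S) = 1 / (k : ℝ) * (1 / (Fintype.card S : ℝ)) := by
          field_simp
      _ ≤ 1 / (k : ℝ) * lowUniform μ k s := by gcongr
      _ ≤ _ := le_add_of_nonneg_right
          (mul_nonneg (div_nonneg (by linarith) (by linarith)) (hμ.1 s))
  · have h1 : 1 / (k : ℝ) ≤ μ s := by
      simpa [lowSet] using hs
    have h2 : (1 : ℝ) / 2 ≤ ((k : ℝ) - 1) / k := by
      rw [div_le_div_iff₀ (by norm_num) (by linarith)]
      linarith
    calc 1 / ((k : ℝ) * Fintype.card S) ≤ 1 / 2 * (1 / (k : ℝ)) := by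
          rw [div_mul_div_comm, one_mul]
          apply one_div_le_one_div_of_le (by linarith)
          nlinarith
      _ ≤ ((k : ℝ) - 1) / k * μ s := by gcongr
      _ ≤ _ := le_add_of_nonneg_left (mul_nonneg (by positivity) (h.1 s))

end Perturbed

/-! ### The transition matrix of a positive weight: lower bounds and reversibility. -/

section TransMatrix

variable {S : Type*} [Fintype S] {w : S → ℝ} {G : SimpleGraph S} {e : S ≃ Fin (Fintype.card S)}

lemma rowWeight_nonneg (hw : ∀ s, 0 ≤ w s) (s : S) : 0 ≤ rowWeight w G e s := by
  classical
  unfold rowWeight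
  refine add_nonneg (Finset.sum_nonneg fun x _ => ?_) (Finset.sum_nonneg fun x _ => ?_)
  · split_ifs <;> norm_num
  · split_ifs
    · exact div_nonneg (hw x) (hw s)
    · exact le_rfl

lemma rowWeight_pos [Nontrivial S] (hG : G.Connected) (hw : ∀ s, 0 < w s) (s : S) :
    0 < rowWeight w G e s := by
  classical
  obtain ⟨u, hu⟩ := hG.preconnected.exists_adj_of_nontrivial s
  have hne : e s ≠ e u := fun h => hu.ne (e.injective h)
  have h1 : ∀ x ∈ (Finset.univ : Finset S),
      (0 : ℝ) ≤ if e s < e x ∧ G.Adj s x then 1 else 0 := by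
    intro x _
    split_ifs <;> norm_num
  have h2 : ∀ x ∈ (Finset.univ : Finset S),
      (0 : ℝ) ≤ if e x < e s ∧ G.Adj s x then w x / w s else 0 := by
    intro x _
    split_ifs
    · exact (div_pos (hw x) (hw s)).le
    · exact le_rfl
  unfold rowWeight
  rcases lt_or_gt_of_ne hne with h | h
  · refine add_pos_of_pos_of_nonneg ?_ (Finset.sum_nonneg h2)
    refine Finset.sum_pos' h1 ⟨u, Finset.mem_univ u, ?_⟩
    rw [if_pos ⟨h, hu⟩]
    norm_num
  · refine add_pos_of_nonneg_of_pos (Finset.sum_nonneg h1) ?_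
    refine Finset.sum_pos' h2 ⟨u, Finset.mem_univ u, ?_⟩
    rw [if_pos ⟨h, hu⟩]
    exact div_pos (hw u) (hw s)

lemma rowWeight_le {B : ℝ} (hB : 1 ≤ B) (hw : ∀ s s', w s' / w s ≤ B) (s : S) :
    rowWeight w G e s ≤ 2 * Fintype.card S * B := by
  classical
  have h1 : (∑ x : S, if e s < e x ∧ G.Adj s x then (1 : ℝ) else 0) ≤ ∑ _x : S, B :=
    Finset.sum_le_sum fun x _ => by split_ifs <;> linarith
  have h2 : (∑ x : S, if e x < e s ∧ G.Adj s x then w x / w s else 0) ≤ ∑ _x : S, B :=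
    Finset.sum_le_sum fun x _ => by
      split_ifs
      · exact hw s x
      · linarith
  rw [Finset.sum_const, Finset.card_univ, nsmul_eq_mul] at h1 h2
  unfold rowWeight
  linarith

lemma stepProb_mul_rowWeight_le (hw : ∀ s, 0 ≤ w s) (s : S) :
    stepProb w G e * rowWeight w G e s ≤ 1 / 2 := by
  have h0 := rowWeight_nonneg (G := G) (e := e) hw s
  have h1 : stepProb w G e ≤ 1 / (2 * rowWeight w G e s) :=
    ciInf_le (Set.finite_range _).bddBelow s
  rcases h0.eq_or_lt with h | h
  · rw [← h]; norm_num
  · calc _ ≤ 1 / (2 * rowWeight w G e s) * rowWeight w G e s := by gcongr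
      _ = 1 / 2 := by field_simp

lemma le_stepProb [Nontrivial S] (hG : G.Connected) (hw0 : ∀ s, 0 < w s) {B : ℝ} (hB : 1 ≤ B)
    (hw : ∀ s s', w s' / w s ≤ B) : 1 / (4 * Fintype.card S * B) ≤ stepProb w G e := by
  refine le_ciInf fun s => ?_
  refine one_div_le_one_div_of_le (mul_pos two_pos (rowWeight_pos hG hw0 s)) ?_
  have := rowWeight_le (G := G) (e := e) hB hw s
  linarith

/-- One factor `B` comes from the bound on `p`, the other from `w s' / w s ≥ 1 / B` on moves to a
smaller label. The diagonal is at least `1/2`. -/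
lemma le_transMatrix [Nontrivial S] (hG : G.Connected) (hw0 : ∀ s, 0 < w s) {B : ℝ} (hB : 1 ≤ B)
    (hw : ∀ s s', w s' / w s ≤ B) {s s' : S} (h : s = s' ∨ G.Adj s s') :
    1 / (4 * Fintype.card S * B ^ 2) ≤ transMatrix w G e s s' := by
  classical
  have hN : (1 : ℝ) ≤ Fintype.card S := by exact_mod_cast Fintype.card_pos
  have hp := le_stepProb (e := e) hG hw0 hB hw
  have hB2 : B ≤ B ^ 2 := by nlinarith
  have hp' : 1 / (4 * Fintype.card S * B ^ 2) ≤ 1 / (4 * Fintype.card S * B) := by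
    apply one_div_le_one_div_of_le
    · nlinarith
    · gcongr
  unfold transMatrix
  by_cases hs : s = s'
  · rw [if_pos hs]
    have h1 := stepProb_mul_rowWeight_le (G := G) (e := e) (fun s => (hw0 s).le) s
    have h2 : 1 / (4 * Fintype.card S * B) ≤ 1 / 2 := by
      apply one_div_le_one_div_of_le (by norm_num)
      nlinarith
    linarith
  · rw [if_neg hs, if_pos (h.resolve_left hs)]
    split_ifs
    · linarith
    · have h0 : 0 < w s' / w s := div_pos (hw0 s') (hw0 s)
      have h1 : 1 / B ≤ w s' / w s := by
        have h2 := hw s' s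
        have h3 : 0 < w s / w s' := div_pos (hw0 s) (hw0 s')
        rw [← one_div_div (w s) (w s')]
        exact one_div_le_one_div_of_le h3 h2
      calc 1 / (4 * Fintype.card S * B ^ 2) = 1 / B * (1 / (4 * Fintype.card S * B)) := by
            field_simp
        _ ≤ _ := by gcongr

lemma transMatrix_eq_zero {s s' : S} (h : ¬ (s = s' ∨ G.Adj s s')) :
    transMatrix w G e s s' = 0 := by
  push Not at h
  simp [transMatrix, h.1, h.2]

/-- Across an edge both sides equal `p` times the weight of the endpoint with the smaller label. -/
lemma transMatrix_reversible (hw0 : ∀ s, w s ≠ 0) (s s' : S) :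
    w s * transMatrix w G e s s' = w s' * transMatrix w G e s' s := by
  classical
  have h1 := hw0 s
  have h2 := hw0 s'
  by_cases hs : s = s'
  · rw [hs]
  by_cases ha : G.Adj s s'
  · have hne : e s ≠ e s' := fun h => hs (e.injective h)
    simp only [transMatrix, if_neg hs, if_neg (Ne.symm hs), if_pos ha, if_pos ha.symm]
    rcases lt_or_gt_of_ne hne with h | h
    · rw [if_pos h, if_neg h.not_gt]
      field_simp
    · rw [if_neg h.not_gt, if_pos h]
      field_simp
  · rw [transMatrix_eq_zero (by tauto), transMatrix_eq_zero (by rw [G.adj_comm, eq_comm]; tauto)]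
    simp

lemma vecMul_transMatrix (hw0 : ∀ s, w s ≠ 0)
    (hst : ∀ s, transMatrix w G e s ∈ stdSimplex ℝ S) :
    Matrix.vecMul w (transMatrix w G e) = w := by
  funext s
  simp only [Matrix.vecMul, dotProduct, transMatrix_reversible hw0 _ s]
  rw [← Finset.mul_sum, (hst s).2, mul_one]

end TransMatrix

/-! ### Explicit bounds for the matrices of block `k`. -/

section PerturbedMatrix

variable {S : Type*} [Fintype S] {μ : S → ℝ} {G : SimpleGraph S}

lemma perturbed_pos (hμ : μ ∈ stdSimplex ℝ S) (hz : ∃ s, μ s = 0) {k : ℕ} (hk : 2 ≤ k) (s : S) :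
    0 < perturbed μ k s := by
  have h2 := one_lt_card_of_exists_eq_zero hμ hz
  refine lt_of_lt_of_le ?_ (one_div_le_perturbed hμ hz hk s)
  have : (0 : ℝ) < k := by exact_mod_cast (by omega : 0 < k)
  have : (0 : ℝ) < Fintype.card S := by exact_mod_cast (by omega : 0 < Fintype.card S)
  positivity

lemma le_transMatrix_perturbed (hG : G.Connected) (hμ : μ ∈ stdSimplex ℝ S)
    (hz : ∃ s, μ s = 0) (e : S ≃ Fin (Fintype.card S)) {k : ℕ} (hk : 2 ≤ k) {s s' : S}
    (h : s = s' ∨ G.Adj s s') :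
    1 / (4 * (Fintype.card S : ℝ) ^ 3) / (k : ℝ) ^ 2 ≤ transMatrix (perturbed μ k) G e s s' := by
  have h2 := one_lt_card_of_exists_eq_zero hμ hz
  have : Nontrivial S := Fintype.one_lt_card_iff_nontrivial.1 h2
  have hk' : (2 : ℝ) ≤ k := by exact_mod_cast hk
  have hN : (2 : ℝ) ≤ Fintype.card S := by exact_mod_cast h2
  -- Weights lie between `1 / (k |S|)` and `1`, so their ratios are at most `B = k |S|`.
  have key := le_transMatrix (w := perturbed μ k) (e := e) hG (perturbed_pos hμ hz hk)
    (B := k * Fintype.card S) (by nlinarith) (fun x y => ?_) h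
  · refine le_trans (le_of_eq ?_) key
    field_simp
  · rw [div_le_iff₀ (perturbed_pos hμ hz hk x)]
    have h3 := one_div_le_perturbed hμ hz hk x
    rw [div_le_iff₀ (by positivity)] at h3
    have h4 := le_one_of_mem_stdSimplex (perturbed_mem_stdSimplex hμ hz (by omega : 1 ≤ k)) y
    linarith

end PerturbedMatrix

/-! ### Marginals and correlations of a Markov chain. -/

section MarkovProperty

variable {Ω S : Type*} [MeasurableSpace Ω] [Fintype S] [MeasurableSpace S]
  [MeasurableSingletonClass S] {P : Measure Ω} [IsProbabilityMeasure P]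

lemma measureReal_eq_sum_inter {f : Ω → S} (hf : Measurable f) (A : Set Ω) :
    P.real A = ∑ z, P.real (A ∩ {ω | f ω = z}) := by
  have h := sum_measureReal_preimage_singleton (μ := P.restrict A) (f := f) Finset.univ
    (fun y _ => hf (measurableSet_singleton y))
  simp only [Finset.coe_univ, Set.preimage_univ] at h
  rw [measureReal_restrict_apply MeasurableSet.univ, Set.univ_inter] at h
  rw [← h]
  refine Finset.sum_congr rfl fun z _ => ?_
  rw [measureReal_restrict_apply (hf (measurableSet_singleton z)), Set.inter_comm]
  rfl

variable {init : S → ℝ} {Q : ℕ → Matrix S S ℝ} {X : ℕ → Ω → S}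

lemma IsMarkovChain.law_past_future (hX : IsMarkovChain P init Q X) (j : ℕ) :
    ∀ (m : ℕ) (x : ℕ → S) (y : S),
    P.real {ω | (∀ t ≤ m, X t ω = x t) ∧ X (m + j) ω = y} =
      P.real {ω | ∀ t ≤ m, X t ω = x t} * transProd Q m j (x m) y := by
  classical
  induction j with
  | zero =>
    intro m x y
    simp only [add_zero, transProd, Matrix.one_apply]
    by_cases hxy : x m = y
    · have : {ω | (∀ t ≤ m, X t ω = x t) ∧ X m ω = y} = {ω | ∀ t ≤ m, X t ω = x t} := by
        ext ω
        exact ⟨fun h => h.1, fun h => ⟨h, (h m le_rfl).trans hxy⟩⟩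
      rw [if_pos hxy, this, mul_one]
    · have : {ω | (∀ t ≤ m, X t ω = x t) ∧ X m ω = y} = ∅ := by
        ext ω
        simp only [Set.mem_ofPred_eq, Set.mem_empty_iff_false, iff_false]
        exact fun h => hxy ((h.1 m le_rfl).symm.trans h.2)
      rw [if_neg hxy, this, mul_zero, measureReal_empty]
  | succ j ih =>
    intro m x y
    rw [measureReal_eq_sum_inter (hX.measurable (m + 1)), transProd_succ, Matrix.mul_apply,
      Finset.mul_sum]
    refine Finset.sum_congr rfl fun z _ => ?_
    have hset : {ω | (∀ t ≤ m, X t ω = x t) ∧ X (m + (j + 1)) ω = y} ∩ {ω | X (m + 1) ω = z} =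
        {ω | (∀ t ≤ m + 1, X t ω = Function.update x (m + 1) z t) ∧ X (m + 1 + j) ω = y} := by
      ext ω
      simp only [Set.mem_inter_iff, Set.mem_ofPred_eq, show m + (j + 1) = m + 1 + j by ring]
      constructor
      · rintro ⟨⟨h1, h2⟩, h3⟩
        refine ⟨fun t ht => ?_, h2⟩
        rcases Nat.le_succ_iff.1 ht with ht' | rfl
        · rw [Function.update_of_ne (by omega), h1 t ht']
        · simpa using h3
      · rintro ⟨h1, h2⟩
        refine ⟨⟨fun t ht => ?_, h2⟩, by simpa using h1 (m + 1) le_rfl⟩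
        rw [h1 t (by omega), Function.update_of_ne (by omega)]
    rw [hset, ih (m + 1), hX.law, hX.law, Finset.prod_range_succ,
      Function.update_of_ne (by omega : 0 ≠ m + 1), Function.update_of_ne (by omega : m ≠ m + 1),
      Function.update_self, Finset.prod_congr rfl fun t ht => by
        have := Finset.mem_range.1 ht
        rw [Function.update_of_ne (by omega : t ≠ m + 1),
          Function.update_of_ne (by omega : t + 1 ≠ m + 1)]]
    ring

/-- The two-time marginals of a Markov chain. -/
lemma IsMarkovChain.law_pair (hX : IsMarkovChain P init Q X) (m j : ℕ) (a y : S) :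
    P.real {ω | X m ω = a ∧ X (m + j) ω = y} =
      P.real {ω | X m ω = a} * transProd Q m j a y := by
  classical
  -- The recorded history up to time `i` is summed out one time at a time, from `i = m` down to `i =
  -- 0`.
  have H : ∀ d i, i + d = m → ∀ x : ℕ → S,
      P.real {ω | (∀ t ≤ i, X t ω = x t) ∧ X m ω = a ∧ X (m + j) ω = y} =
      P.real {ω | (∀ t ≤ i, X t ω = x t) ∧ X m ω = a} * transProd Q m j a y := by
    intro d
    induction d with
    | zero =>
      rintro i rfl x
      by_cases hx : x i = a
      · have h := hX.law_past_future j i x y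
        rw [hx] at h
        have e1 : {ω | (∀ t ≤ i, X t ω = x t) ∧ X i ω = a ∧ X (i + j) ω = y} =
            {ω | (∀ t ≤ i, X t ω = x t) ∧ X (i + j) ω = y} := by
          ext ω
          exact ⟨fun h => ⟨h.1, h.2.2⟩, fun h => ⟨h.1, (h.1 i le_rfl).trans hx, h.2⟩⟩
        have e2 : {ω | (∀ t ≤ i, X t ω = x t) ∧ X i ω = a} = {ω | ∀ t ≤ i, X t ω = x t} := by
          ext ω
          exact ⟨fun h => h.1, fun h => ⟨h, (h i le_rfl).trans hx⟩⟩
        simp only [add_zero]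
        rw [e1, e2, h]
      · have e1 : {ω | (∀ t ≤ i, X t ω = x t) ∧ X i ω = a ∧ X (i + j) ω = y} = ∅ := by
          ext ω
          simp only [Set.mem_ofPred_eq, Set.mem_empty_iff_false, iff_false]
          exact fun h => hx ((h.1 i le_rfl).symm.trans h.2.1)
        have e2 : {ω | (∀ t ≤ i, X t ω = x t) ∧ X i ω = a} = ∅ := by
          ext ω
          simp only [Set.mem_ofPred_eq, Set.mem_empty_iff_false, iff_false]
          exact fun h => hx ((h.1 i le_rfl).symm.trans h.2)
        simp only [add_zero]
        rw [e1, e2]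
        simp
    | succ d ih =>
      rintro i hi x
      have hset : ∀ (z : S) (R : Ω → Prop),
          {ω | (∀ t ≤ i, X t ω = x t) ∧ R ω} ∩ {ω | X (i + 1) ω = z} =
          {ω | (∀ t ≤ i + 1, X t ω = Function.update x (i + 1) z t) ∧ R ω} := by
        intro z R
        ext ω
        simp only [Set.mem_inter_iff, Set.mem_ofPred_eq]
        constructor
        · rintro ⟨⟨h1, h2⟩, h3⟩
          refine ⟨fun t ht => ?_, h2⟩
          rcases Nat.le_succ_iff.1 ht with ht' | rfl
          · rw [Function.update_of_ne (by omega), h1 t ht']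
          · simpa using h3
        · rintro ⟨h1, h2⟩
          refine ⟨⟨fun t ht => ?_, h2⟩, by simpa using h1 (i + 1) le_rfl⟩
          rw [h1 t (by omega), Function.update_of_ne (by omega)]
      rw [measureReal_eq_sum_inter (hX.measurable (i + 1)),
        measureReal_eq_sum_inter (hX.measurable (i + 1))
          {ω | (∀ t ≤ i, X t ω = x t) ∧ X m ω = a}, Finset.sum_mul]
      refine Finset.sum_congr rfl fun z _ => ?_
      rw [hset, hset, ih (i + 1) (by omega)]
  have hset : ∀ (z : S) (R : Ω → Prop), {ω | R ω} ∩ {ω | X 0 ω = z} =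
      {ω | (∀ t ≤ 0, X t ω = (fun _ => z) t) ∧ R ω} := by
    intro z R
    ext ω
    simp [and_comm]
  rw [measureReal_eq_sum_inter (hX.measurable 0),
    measureReal_eq_sum_inter (hX.measurable 0) {ω | X m ω = a}, Finset.sum_mul]
  refine Finset.sum_congr rfl fun z _ => ?_
  rw [hset, hset, H m 0 (by omega)]

lemma IsMarkovChain.law_add (hX : IsMarkovChain P init Q X) (m j : ℕ) :
    (fun y => P.real {ω | X (m + j) ω = y}) =
      Matrix.vecMul (fun a => P.real {ω | X m ω = a}) (transProd Q m j) := by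
  funext y
  rw [measureReal_eq_sum_inter (hX.measurable m)]
  refine Finset.sum_congr rfl fun a _ => ?_
  rw [← hX.law_pair m j a y]
  congr 1
  ext ω
  simp [and_comm]

lemma IsMarkovChain.law_mem_stdSimplex (hX : IsMarkovChain P init Q X) (m : ℕ) :
    (fun a => P.real {ω | X m ω = a}) ∈ stdSimplex ℝ S := by
  refine ⟨fun a => measureReal_nonneg, ?_⟩
  have := measureReal_eq_sum_inter (P := P) (hX.measurable m) Set.univ
  simpa using this.symm

/-- Correlations of a Markov chain are bounded by the contraction of its transition matrices. -/
lemma IsMarkovChain.abs_law_pair_sub_le (hX : IsMarkovChain P init Q X) (m j : ℕ) (s : S) {b : ℝ}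
    (hb0 : 0 ≤ b) (hb : ∀ v : S → ℝ, ∑ x, v x = 0 →
      ∑ x, |Matrix.vecMul v (transProd Q m j) x| ≤ b * ∑ x, |v x|) :
    |P.real {ω | X m ω = s ∧ X (m + j) ω = s} -
      P.real {ω | X m ω = s} * P.real {ω | X (m + j) ω = s}| ≤ b * 2 := by
  classical
  have hν := hX.law_mem_stdSimplex m
  set ν : S → ℝ := fun a => P.real {ω | X m ω = a} with hνdef
  -- The point mass at `s` minus the law at time `m`: the covariance is `ν s` times the `s`-entry of
  -- `v` propagated `j` steps. The final factor `2` bounds the `ℓ¹` norm of `v`.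
  set v : S → ℝ := (Pi.single s 1 : S → ℝ) - ν with hvdef
  have hv : ∑ x, v x = 0 := by
    simp [hvdef, Finset.sum_sub_distrib, hν.2]
  have hv2 : ∑ x, |v x| ≤ 2 := by
    calc ∑ x, |v x| ≤ ∑ x, (|(Pi.single s 1 : S → ℝ) x| + |ν x|) :=
          Finset.sum_le_sum fun x _ => abs_sub _ _
      _ = 1 + 1 := by
          rw [Finset.sum_add_distrib]
          congr 1
          · simp [Pi.single_apply, apply_ite abs]
          · rw [← hν.2]
            exact Finset.sum_congr rfl fun x _ => abs_of_nonneg (hν.1 x)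
      _ = 2 := by norm_num
  have hadd := congrFun (hX.law_add m j) s
  have hval : Matrix.vecMul v (transProd Q m j) s =
      transProd Q m j s s - P.real {ω | X (m + j) ω = s} := by
    rw [hadd, hvdef, Matrix.sub_vecMul]
    simp [hνdef]
  have h1 : |Matrix.vecMul v (transProd Q m j) s| ≤ b * ∑ x, |v x| :=
    (Finset.single_le_sum (f := fun x => |Matrix.vecMul v (transProd Q m j) x|)
      (fun x _ => abs_nonneg _) (Finset.mem_univ s)).trans (hb v hv)
  have h2 : P.real {ω | X m ω = s ∧ X (m + j) ω = s} -
      P.real {ω | X m ω = s} * P.real {ω | X (m + j) ω = s} =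
      ν s * Matrix.vecMul v (transProd Q m j) s := by
    rw [hX.law_pair, hval]
    ring
  rw [h2, abs_mul, abs_of_nonneg (hν.1 s)]
  calc ν s * |Matrix.vecMul v (transProd Q m j) s| ≤ 1 * (b * ∑ x, |v x|) :=
        mul_le_mul (le_one_of_mem_stdSimplex hν s) h1 (abs_nonneg _) zero_le_one
    _ ≤ b * 2 := by
        rw [one_mul]
        exact mul_le_mul_of_nonneg_left hv2 hb0

end MarkovProperty

/-! ### Growth of the block times and a geometric sum. -/

section Blocks

/-- A strictly increasing sequence of naturals is unbounded, so some block contains `t`. -/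
lemma exists_block {T : ℕ → ℕ} (hT : StrictMonoOn T (Set.Ici 1)) {k t : ℕ} (hk : 1 ≤ k)
    (ht : T k ≤ t) : ∃ K, k ≤ K ∧ T K ≤ t ∧ t < T (K + 1) := by
  by_contra! h
  have h1 : ∀ i, T (k + i) ≤ t := by
    intro i
    induction i with
    | zero => exact ht
    | succ i ih => exact h (k + i) (by omega) ih
  have h2 : ∀ i, i ≤ T (k + i) := by
    intro i
    induction i with
    | zero => omega
    | succ i ih =>
      have := hT (show k + i ∈ Set.Ici 1 by simp; omega) (show k + (i + 1) ∈ Set.Ici 1 by simp; omega)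
        (by omega)
      omega
  have := h1 (t + 1)
  have := h2 (t + 1)
  omega

lemma add_one_pow_le {x : ℝ} (hx : 0 ≤ x) (q : ℕ) :
    (x + 1) ^ (q + 1) ≤ x ^ (q + 1) + (q + 1) * (x + 1) ^ q := by
  induction q with
  | zero => simp
  | succ q ih =>
    have h1 : x ^ (q + 1) ≤ (x + 1) ^ (q + 1) := by gcongr; linarith
    calc (x + 1) ^ (q + 1 + 1) = (x + 1) ^ (q + 1) * (x + 1) := pow_succ _ _
      _ ≤ (x ^ (q + 1) + (q + 1) * (x + 1) ^ q) * (x + 1) := by gcongr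
      _ = x ^ (q + 1 + 1) + x ^ (q + 1) + (q + 1) * (x + 1) ^ (q + 1) := by ring
      _ ≤ x ^ (q + 1 + 1) + (x + 1) ^ (q + 1) + (q + 1) * (x + 1) ^ (q + 1) := by gcongr
      _ = _ := by push_cast; ring

/-- If the gaps of `T` grow at least like `l ^ q`, then `T K` grows at least like
`K ^ (q + 1)`. -/
lemma exists_pow_le_of_gap {T : ℕ → ℕ} {c : ℝ} (hc : 0 < c) {q : ℕ}
    (hgap : ∀ l : ℕ, 1 ≤ l → c * (l : ℝ) ^ q ≤ (T (l + 1) : ℝ) - (T l : ℝ)) :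
    ∃ D : ℝ, 0 < D ∧ ∀ K t : ℕ, 1 ≤ K → 1 ≤ t → T K ≤ t → (K : ℝ) ^ (q + 1) ≤ D * t := by
  -- Chosen so that `c' ((K+1)^(q+1) - K^(q+1)) ≤ c K^q`; the power of two comes from `K + 1 ≤ 2 K`.
  set c' : ℝ := c / ((q + 1) * 2 ^ q) with hc'
  have hc'0 : 0 < c' := by positivity
  have hcc : c' * ((q + 1) * 2 ^ q) = c := by
    rw [hc']
    field_simp
  have key : ∀ K : ℕ, 1 ≤ K → c' * ((K : ℝ) ^ (q + 1) - 1) ≤ T K := by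
    intro K hK
    induction K, hK using Nat.le_induction with
    | base => simp
    | succ K hK ih =>
      have hK' : (1 : ℝ) ≤ K := by exact_mod_cast hK
      have h1 := hgap K hK
      have h2 := add_one_pow_le (x := (K : ℝ)) (by linarith) q
      have h3 : ((K : ℝ) + 1) ^ q ≤ 2 ^ q * (K : ℝ) ^ q := by
        rw [← mul_pow]
        gcongr
        linarith
      have h4 : c' * ((q + 1) * ((K : ℝ) + 1) ^ q) ≤ c * (K : ℝ) ^ q := by
        calc _ ≤ c' * ((q + 1) * (2 ^ q * (K : ℝ) ^ q)) := by gcongr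
          _ = c' * ((q + 1) * 2 ^ q) * (K : ℝ) ^ q := by ring
          _ = _ := by rw [hcc]
      have h5 := mul_le_mul_of_nonneg_left h2 hc'0.le
      push_cast
      linarith
  refine ⟨1 / c' + 1, by positivity, fun K t hK ht hKt => ?_⟩
  have h1 := key K hK
  have h2 : (T K : ℝ) ≤ t := by exact_mod_cast hKt
  have h3 : (1 : ℝ) ≤ t := by exact_mod_cast ht
  have h4 : (K : ℝ) ^ (q + 1) - 1 ≤ t / c' := by
    rw [le_div_iff₀ hc'0]
    linarith
  calc (K : ℝ) ^ (q + 1) ≤ t / c' + 1 := by linarith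
    _ ≤ t / c' + t := by linarith
    _ = _ := by ring

/-- Truncated subtraction makes the first `a` terms equal to `1`; afterwards each power of `ρ`
occurs at most `N` times. -/
lemma sum_pow_div_le {ρ : ℝ} (h0 : 0 ≤ ρ) (h1 : ρ < 1) {N : ℕ} (hN : 1 ≤ N) (a t : ℕ) :
    ∑ j ∈ Finset.range t, ρ ^ ((j - a) / N) ≤ a + N / (1 - ρ) := by
  have hgeom : ∑ i ∈ Finset.range t, ρ ^ i ≤ 1 / (1 - ρ) := by
    rw [le_div_iff₀ (by linarith), geom_sum_mul_neg]
    linarith [pow_nonneg h0 t]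
  have hblock : ∀ u : ℕ, ∑ i ∈ Finset.range (N * u), ρ ^ (i / N) =
      N * ∑ i ∈ Finset.range u, ρ ^ i := by
    intro u
    induction u with
    | zero => simp
    | succ u ih =>
      rw [Nat.mul_succ, Finset.sum_range_add, ih, Finset.sum_range_succ, mul_add]
      congr 1
      rw [Finset.sum_congr rfl fun i hi => by
        rw [Nat.mul_add_div (by omega), Nat.div_eq_of_lt (Finset.mem_range.1 hi), add_zero]]
      simp
  calc ∑ j ∈ Finset.range t, ρ ^ ((j - a) / N)
      ≤ ∑ j ∈ Finset.range (a + N * t), ρ ^ ((j - a) / N) :=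
        Finset.sum_le_sum_of_subset_of_nonneg (Finset.range_mono (by nlinarith))
          fun _ _ _ => pow_nonneg h0 _
    _ = ∑ j ∈ Finset.range a, ρ ^ ((j - a) / N) + N * ∑ i ∈ Finset.range t, ρ ^ i := by
        rw [Finset.sum_range_add, ← hblock]
        simp
    _ ≤ ∑ _j ∈ Finset.range a, (1 : ℝ) + N * (1 / (1 - ρ)) := by
        gcongr
        exact pow_le_one₀ h0 h1.le
    _ = _ := by simp; ring

end Blocks

/-! ### Mixing of a single factor. -/

section OneChain

variable {S : Type*} [Fintype S] {G : SimpleGraph S} {μ : S → ℝ}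
  {e : S ≃ Fin (Fintype.card S)} {T : ℕ → ℕ} {k₀ : ℕ} {Q : ℕ → Matrix S S ℝ}

/-- The window may straddle blocks, but all of them have index at most `K`, and smaller indices give
larger entries. Starting at `T (max k₀ 2)` ensures that the matrices are prescribed and that `k ≥
2`. -/
lemma pow_card_le_transProd_of_block (hG : G.Connected) (hμ : μ ∈ stdSimplex ℝ S)
    (hz : ∃ s, μ s = 0) (hT : StrictMonoOn T (Set.Ici 1))
    (hQ : ∀ k, k₀ ≤ k → ∀ t, T k ≤ t → t < T (k + 1) → Q t = transMatrix (perturbed μ k) G e)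
    (hst : ∀ t s, Q t s ∈ stdSimplex ℝ S) {K m : ℕ} (hm : T (max k₀ 2) ≤ m)
    (hmK : m + Fintype.card S ≤ T (K + 1)) (s s' : S) :
    (1 / (4 * (Fintype.card S : ℝ) ^ 3) / (K : ℝ) ^ 2) ^ Fintype.card S ≤
      transProd Q m (Fintype.card S) s s' := by
  refine pow_card_le_transProd hst hG (by positivity) (fun t ht ht' x y hxy => ?_) s s'
  obtain ⟨k, hk, hk1, hk2⟩ := exists_block hT (by omega : 1 ≤ max k₀ 2) (hm.trans ht)
  have hkK : k < K + 1 := (hT.lt_iff_lt (by simp; omega) (by simp)).1 (by omega : T k < T (K + 1))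
  rw [hQ k (by omega) t hk1 hk2]
  refine le_trans ?_ (le_transMatrix_perturbed hG hμ hz e (by omega) hxy)
  have h1 : (k : ℝ) ≤ K := by exact_mod_cast (by omega : k ≤ K)
  have h2 : (0 : ℝ) < k := by exact_mod_cast (by omega : 0 < k)
  gcongr

lemma one_div_four_card_pow_pos [Nonempty S] : 0 < 1 / (4 * (Fintype.card S : ℝ) ^ 3) := by
  have : (0 : ℝ) < Fintype.card S := by exact_mod_cast Fintype.card_pos
  positivity

lemma one_div_four_card_pow_le_one [Nonempty S] : 1 / (4 * (Fintype.card S : ℝ) ^ 3) ≤ 1 := by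
  have h : (1 : ℝ) ≤ Fintype.card S := by exact_mod_cast Fintype.card_pos
  rw [div_le_one (by positivity)]
  linarith [one_le_pow₀ (n := 3) h]

variable {c : ℝ} {Ω : Type*} [MeasurableSpace Ω] [MeasurableSpace S] [MeasurableSingletonClass S]
  {P : Measure Ω} [IsProbabilityMeasure P] {init : S → ℝ} {X : ℕ → Ω → S}

/-- Decay of correlations of the occupation indicators. -/
lemma exists_correlation_bound (hG : G.Connected) (hμ : μ ∈ stdSimplex ℝ S)
    (hz : ∃ s, μ s = 0) (hT : StrictMonoOn T (Set.Ici 1)) (hc : 0 < c)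
    (hgap : ∀ l : ℕ, 1 ≤ l →
      c * (l : ℝ) ^ (5 * Fintype.card S - 1) ≤ (T (l + 1) : ℝ) - (T l : ℝ))
    (hQ : ∀ k, k₀ ≤ k → ∀ t, T k ≤ t → t < T (k + 1) → Q t = transMatrix (perturbed μ k) G e)
    (hX : IsMarkovChain P init Q X) (s : S) :
    ∃ C : ℝ, ∀ n : ℕ, 1 ≤ n → ∃ b : ℕ → ℝ, (∀ j, 0 ≤ b j) ∧
      (∀ m j, m + j < n ^ 5 → |P.real {ω | X m ω = s ∧ X (m + j) ω = s} -
        P.real {ω | X m ω = s} * P.real {ω | X (m + j) ω = s}| ≤ b j) ∧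
      ∑ j ∈ Finset.range (n ^ 5), b j ≤ C * (n : ℝ) ^ 2 := by
  have : Nonempty S := ⟨s⟩
  set N := Fintype.card S with hNdef
  have hN : 1 ≤ N := Fintype.card_pos
  obtain ⟨D, hD, hKD⟩ := exists_pow_le_of_gap hc hgap
  set α : ℝ := 1 / (4 * (N : ℝ) ^ 3)
  have hα : 0 < α := one_div_four_card_pow_pos
  have hα1 : α ≤ 1 := one_div_four_card_pow_le_one
  set a := T (max k₀ 2)
  refine ⟨2 * a + 2 * (N * (D + 1) ^ 2 / α ^ N), fun n hn => ?_⟩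
  have hn' : (1 : ℝ) ≤ n := by exact_mod_cast hn
  -- Before time `n^5` the block index satisfies `K^(5N) ≤ D n^5`, so `K^N ≤ (D+1) n`, and `(α /
  -- K²)^N` is at least this `ε`.
  set ε : ℝ := α ^ N / ((D + 1) * n) ^ 2 with hε
  have hε0 : 0 < ε := by positivity
  have hDn : 1 ≤ (D + 1) * n := by nlinarith
  have hε1 : ε ≤ 1 := by
    rw [hε, div_le_one (by positivity)]
    exact (pow_le_one₀ hα.le hα1).trans (one_le_pow₀ hDn)
  have hlow : ∀ m, a ≤ m → m + N ≤ n ^ 5 → ∀ x y, ε ≤ transProd Q m N x y := by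
    intro m hm hmn x y
    -- `m + N - 1` is the time of the last matrix in the window.
    obtain ⟨K, hK, hK1, hK2⟩ := exists_block hT (by omega : 1 ≤ max k₀ 2)
      (by omega : T (max k₀ 2) ≤ m + N - 1)
    refine le_trans ?_ (pow_card_le_transProd_of_block hG hμ hz hT hQ hX.stochastic hm
      (by omega : m + N ≤ T (K + 1)) x y)
    have h1 := hKD K (n ^ 5) (by omega) (Nat.one_le_pow _ _ hn) (by omega)
    rw [show 5 * N - 1 + 1 = N * 5 by omega, pow_mul] at h1
    have h2 : (K : ℝ) ^ N ≤ (D + 1) * n := by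
      refine le_of_pow_le_pow_left₀ (n := 5) (by norm_num) (by positivity) (h1.trans ?_)
      push_cast
      rw [mul_pow]
      gcongr
      calc D ≤ D + 1 := by linarith
        _ ≤ (D + 1) ^ 5 := le_self_pow₀ (by linarith) (by norm_num)
    have hK0 : (0 : ℝ) < K := by exact_mod_cast (by omega : 0 < K)
    change ε ≤ (α / (K : ℝ) ^ 2) ^ N
    rw [hε, div_pow α ((K : ℝ) ^ 2) N, ← pow_mul, mul_comm 2 N, pow_mul]
    gcongr
  -- The first `a` steps after `m` are only used as non-expansive, so one bound serves every `m`,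
  -- including starts among arbitrary matrices.
  refine ⟨fun j => (1 - ε) ^ ((j - a) / N) * 2,
    fun j => mul_nonneg (pow_nonneg (by linarith) _) zero_le_two, fun m j hmj => ?_, ?_⟩
  · refine hX.abs_law_pair_sub_le m j s (pow_nonneg (by linarith) _) fun v hv => ?_
    rcases le_total j a with hj | hj
    · rw [Nat.sub_eq_zero_of_le hj, Nat.zero_div, pow_zero, one_mul]
      exact sum_abs_vecMul_le (transProd_mem_stdSimplex hX.stochastic _ _) v
    · obtain ⟨i, rfl⟩ := Nat.exists_eq_add_of_le hj
      rw [transProd_add, ← Matrix.vecMul_vecMul, Nat.add_sub_cancel_left]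
      refine (sum_abs_vecMul_transProd_le hX.stochastic hε0.le hε1 hlow (m := m + a) (j := i)
        (by omega) (by omega) ?_).trans ?_
      · rw [sum_vecMul_of_stochastic (transProd_mem_stdSimplex hX.stochastic _ _), hv]
      · exact mul_le_mul_of_nonneg_left
          (sum_abs_vecMul_le (transProd_mem_stdSimplex hX.stochastic _ _) v)
          (pow_nonneg (by linarith) _)
  · rw [← Finset.sum_mul]
    have h1 := sum_pow_div_le (ρ := 1 - ε) (by linarith) (by linarith) hN a (n ^ 5)
    have h2 : (N : ℝ) / (1 - (1 - ε)) = N * (D + 1) ^ 2 / α ^ N * (n : ℝ) ^ 2 := by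
      rw [sub_sub_cancel, hε]
      field_simp
    have h3 : (a : ℝ) ≤ a * (n : ℝ) ^ 2 :=
      le_mul_of_one_le_right (by positivity) (one_le_pow₀ hn')
    rw [h2] at h1
    linarith

/-- The marginal laws converge to `μ`. -/
lemma tendsto_law (hG : G.Connected) (hμ : μ ∈ stdSimplex ℝ S)
    (hz : ∃ s, μ s = 0) (hT : StrictMonoOn T (Set.Ici 1)) (hc : 0 < c)
    (hgap : ∀ l : ℕ, 1 ≤ l →
      c * (l : ℝ) ^ (5 * Fintype.card S - 1) ≤ (T (l + 1) : ℝ) - (T l : ℝ))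
    (hQ : ∀ k, k₀ ≤ k → ∀ t, T k ≤ t → t < T (k + 1) → Q t = transMatrix (perturbed μ k) G e)
    (hX : IsMarkovChain P init Q X) (s : S) :
    Tendsto (fun m => P.real {ω | X m ω = s}) atTop (𝓝 (μ s)) := by
  have : Nonempty S := ⟨s⟩
  set N := Fintype.card S with hNdef
  have hN : 1 ≤ N := Fintype.card_pos
  have hN' : (1 : ℝ) ≤ N := by exact_mod_cast hN
  set α : ℝ := 1 / (4 * (N : ℝ) ^ 3)
  have hα : 0 < α := one_div_four_card_pow_pos
  have hα1 : α ≤ 1 := one_div_four_card_pow_le_one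
  set ν : ℕ → S → ℝ := fun m x => P.real {ω | X m ω = x} with hν
  have hνs : ∀ m, ν m ∈ stdSimplex ℝ S := fun m => hX.law_mem_stdSimplex m
  set w : ℕ → S → ℝ := fun k => perturbed μ k with hw
  have hws : ∀ k, 1 ≤ k → w k ∈ stdSimplex ℝ S := fun k hk => perturbed_mem_stdSimplex hμ hz hk
  set ε : ℕ → ℝ := fun K => (α / (K : ℝ) ^ 2) ^ N with hε
  have hε0 : ∀ K, 0 ≤ ε K := fun K => by positivity
  have hε1 : ∀ K, 1 ≤ K → ε K ≤ 1 := fun K hK => by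
    have : (1 : ℝ) ≤ K := by exact_mod_cast hK
    refine pow_le_one₀ (by positivity) ?_
    rw [div_le_one (by positivity)]
    exact hα1.trans (one_le_pow₀ this)
  set d : ℕ → ℝ := fun K => ∑ x, |ν (T K) x - w K x| with hd
  have hTle : ∀ K, max k₀ 2 ≤ K → T (max k₀ 2) ≤ T K := fun K hK =>
    hT.monotoneOn (by simp) (by simp; omega) hK
  have hstep : ∀ K, max k₀ 2 ≤ K → ∀ j, T K + j ≤ T (K + 1) →
      ∑ x, |ν (T K + j) x - w K x| ≤ (1 - ε K) ^ (j / N) * d K := by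
    intro K hK j hj
    have hwQ : Matrix.vecMul (w K) (transProd Q (T K) j) = w K := by
      refine vecMul_transProd_eq_self fun t ht ht' => ?_
      have hst := hX.stochastic t
      rw [hQ K (by omega) t ht (by omega)] at hst ⊢
      exact vecMul_transMatrix (fun x => (perturbed_pos hμ hz (by omega) x).ne') hst
    have hdiff : ∀ x, ν (T K + j) x - w K x =
        Matrix.vecMul (ν (T K) - w K) (transProd Q (T K) j) x := by
      intro x
      rw [Matrix.sub_vecMul, hwQ, Pi.sub_apply]
      exact congrArg (· - w K x) (congrFun (hX.law_add (T K) j) x)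
    simp only [hdiff]
    refine sum_abs_vecMul_transProd_le hX.stochastic (hε0 K) (hε1 K (by omega))
      (fun m hm hmb => pow_card_le_transProd_of_block hG hμ hz hT hQ hX.stochastic
        ((hTle K hK).trans hm) hmb) le_rfl hj ?_
    simp [Finset.sum_sub_distrib, (hνs _).2, (hws K (by omega)).2]
  have hd2 : ∀ K, 1 ≤ K → d K ≤ 2 := by
    intro K hK
    calc d K ≤ ∑ x, (ν (T K) x + w K x) := by
          refine Finset.sum_le_sum fun x _ => (abs_sub _ _).trans (le_of_eq ?_)
          rw [abs_of_nonneg ((hνs _).1 x), abs_of_nonneg ((hws K hK).1 x)]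
      _ = 2 := by
          rw [Finset.sum_add_distrib, (hνs _).2, (hws K hK).2]
          norm_num
  have hwμ : ∀ K, 1 ≤ K → ∀ x, |w K x - μ x| ≤ 1 / (K : ℝ) := fun K hK x =>
    abs_perturbed_sub_le hμ hz hK x
  have hsucc : ∀ K, max k₀ 2 ≤ K →
      d (K + 1) ≤ Real.exp (-(α ^ N * c / N * K - 1)) * 2 + N * (2 * (1 / (K : ℝ))) := by
    intro K hK
    have hK1 : (1 : ℝ) ≤ K := by exact_mod_cast (by omega : 1 ≤ K)
    have hlt : T K < T (K + 1) := hT (by simp; omega) (by simp) (by omega)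
    obtain ⟨L, hL⟩ := Nat.exists_eq_add_of_le hlt.le
    have h1 := hstep K hK L hL.ge
    rw [← hL] at h1
    -- A block of length `L ≥ c K^(5N-1) ≥ c K^(2N+1)` gives `ε K * L / N` at least a multiple of
    -- `K`. Rounding `L / N` down costs at most `ε K ≤ 1`, hence the `- 1`.
    have hpow : (1 - ε K) ^ (L / N) ≤ Real.exp (-(α ^ N * c / N * K - 1)) := by
      have hLc : c * (K : ℝ) ^ (5 * N - 1) ≤ L := by
        have := hgap K (by omega)
        rw [hL] at this
        push_cast at this
        linarith
      have hq : (L : ℝ) / N - 1 ≤ ((L / N : ℕ) : ℝ) := by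
        have := Nat.lt_div_mul_add (a := L) (b := N) hN
        have h' : (L : ℝ) ≤ ((L / N : ℕ) : ℝ) * N + N := by exact_mod_cast this.le
        rw [sub_le_iff_le_add, div_le_iff₀ (by linarith)]
        linarith
      have hεK : α ^ N * c / N * K ≤ ε K * (L / N) := by
        have h3 : (K : ℝ) ^ (2 * N) * K ≤ (K : ℝ) ^ (5 * N - 1) := by
          rw [← pow_succ]
          exact pow_le_pow_right₀ hK1 (by omega)
        have h4 : c * ((K : ℝ) ^ (2 * N) * K) ≤ L := by
          refine le_trans ?_ hLc
          gcongr
        calc α ^ N * c / N * K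
            = α ^ N / (K : ℝ) ^ (2 * N) * ((c * ((K : ℝ) ^ (2 * N) * K)) / N) := by
              field_simp
          _ ≤ α ^ N / (K : ℝ) ^ (2 * N) * (L / N) := by gcongr
          _ = ε K * (L / N) := by rw [hε]; simp only [div_pow, ← pow_mul]
      calc (1 - ε K) ^ (L / N) ≤ Real.exp (-ε K) ^ (L / N) := by
            refine pow_le_pow_left₀ ?_ (Real.one_sub_le_exp_neg _) _
            linarith [hε1 K (by omega)]
        _ = Real.exp (-(ε K * ((L / N : ℕ) : ℝ))) := by
            rw [← Real.exp_nat_mul]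
            ring_nf
        _ ≤ _ := by
            refine Real.exp_le_exp.2 (neg_le_neg ?_)
            have h5 := mul_le_mul_of_nonneg_left hq (hε0 K)
            have h6 := hε1 K (by omega)
            linarith
    have h2 : ∑ x, |w K x - w (K + 1) x| ≤ N * (2 * (1 / (K : ℝ))) := by
      calc _ ≤ ∑ _x : S, 2 * (1 / (K : ℝ)) := by
            refine Finset.sum_le_sum fun x _ => ?_
            have h3 := hwμ K (by omega) x
            have h4 := hwμ (K + 1) (by omega) x
            have h5 : 1 / ((K + 1 : ℕ) : ℝ) ≤ 1 / K :=
              one_div_le_one_div_of_le (by linarith) (by push_cast; linarith)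
            rw [abs_sub_comm] at h4
            linarith [abs_sub_le (w K x) (μ x) (w (K + 1) x)]
        _ = _ := by simp [hNdef]
    calc d (K + 1) ≤ ∑ x, (|ν (T (K + 1)) x - w K x| + |w K x - w (K + 1) x|) :=
          Finset.sum_le_sum fun x _ => abs_sub_le _ _ _
      _ ≤ (1 - ε K) ^ (L / N) * d K + N * (2 * (1 / (K : ℝ))) := by
          rw [Finset.sum_add_distrib]
          exact add_le_add h1 h2
      _ ≤ _ := by
          have := hd2 K (by omega)
          have : 0 ≤ d K := Finset.sum_nonneg fun x _ => abs_nonneg _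
          gcongr
  have hd0 : Tendsto d atTop (𝓝 0) := by
    rw [← tendsto_add_atTop_iff_nat 1]
    have hlim : Tendsto (fun K : ℕ => Real.exp (-(α ^ N * c / N * K - 1)) * 2 +
        N * (2 * (1 / (K : ℝ)))) atTop (𝓝 (0 * 2 + N * (2 * 0))) := by
      refine (Tendsto.mul_const 2 ?_).add
        ((tendsto_one_div_atTop_nhds_zero_nat.const_mul 2).const_mul _)
      refine Real.tendsto_exp_neg_atTop_nhds_zero.comp ?_
      exact tendsto_atTop_add_const_right _ _
        (tendsto_natCast_atTop_atTop.const_mul_atTop (by positivity))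
    simp only [zero_mul, mul_zero, add_zero] at hlim
    refine squeeze_zero' (Eventually.of_forall fun K => Finset.sum_nonneg fun x _ => abs_nonneg _)
      ?_ hlim
    filter_upwards [eventually_ge_atTop (max k₀ 2)] with K hK using hsucc K hK
  rw [Metric.tendsto_atTop]
  intro δ hδ
  have hsum : Tendsto (fun K : ℕ => d K + 1 / (K : ℝ)) atTop (𝓝 (0 + 0)) :=
    hd0.add tendsto_one_div_atTop_nhds_zero_nat
  rw [add_zero] at hsum
  obtain ⟨K₁, hK₁⟩ := eventually_atTop.1 (hsum.eventually_lt_const hδ)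
  refine ⟨T (max K₁ (max k₀ 2)), fun m hm => ?_⟩
  obtain ⟨K, hK, hKm, hmK⟩ := exists_block hT (by omega) hm
  obtain ⟨j, rfl⟩ := Nat.exists_eq_add_of_le hKm
  have h1 := hstep K (by omega) j hmK.le
  -- Inside a block the distance to `w K` never exceeds its initial value, so control at block
  -- starts reaches all times.
  have h2 : (1 - ε K) ^ (j / N) * d K ≤ d K := by
    refine mul_le_of_le_one_left (Finset.sum_nonneg fun x _ => abs_nonneg _) ?_
    exact pow_le_one₀ (by linarith [hε1 K (by omega)]) (by linarith [hε0 K])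
  have h3 : |ν (T K + j) s - w K s| ≤ ∑ x, |ν (T K + j) x - w K x| :=
    Finset.single_le_sum (f := fun x => |ν (T K + j) x - w K x|) (fun x _ => abs_nonneg _)
      (Finset.mem_univ s)
  have h4 := hwμ K (by omega) s
  have h5 := hK₁ K (by omega)
  rw [Real.dist_eq]
  linarith [abs_sub_le (ν (T K + j) s) (w K s) (μ s)]

end OneChain

/-! ### A strong law from variances along fifth powers. -/

section Averages

variable {Ω : Type*} [MeasurableSpace Ω] {P : Measure Ω}

/-- The sum of the `Z n` has finite expectation, so it converges almost surely. -/
lemma ae_tendsto_zero_of_summable_integral {Z : ℕ → Ω → ℝ} (hZ0 : ∀ n ω, 0 ≤ Z n ω)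
    (hZ : ∀ n, Integrable (Z n) P) {b : ℕ → ℝ} (hb : Summable b) (hZb : ∀ n, ∫ ω, Z n ω ∂P ≤ b n) :
    ∀ᵐ ω ∂P, Tendsto (fun n => Z n ω) atTop (𝓝 0) := by
  have hm : ∀ n, AEMeasurable (fun ω => ENNReal.ofReal (Z n ω)) P :=
    fun n => (hZ n).1.aemeasurable.ennreal_ofReal
  have hfin : ∫⁻ ω, ∑' n, ENNReal.ofReal (Z n ω) ∂P ≠ ⊤ := by
    rw [lintegral_tsum hm]
    refine ne_top_of_le_ne_top hb.tsum_ofReal_ne_top (ENNReal.tsum_le_tsum fun n => ?_)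
    rw [← ofReal_integral_eq_lintegral_ofReal (hZ n) (ae_of_all _ (hZ0 n))]
    exact ENNReal.ofReal_le_ofReal (hZb n)
  filter_upwards [ae_lt_top' (AEMeasurable.tsum hm) hfin] with ω hω
  have h := ENNReal.tendsto_atTop_zero_of_tsum_ne_top hω.ne
  have h2 := (ENNReal.tendsto_toReal ENNReal.zero_ne_top).comp h
  refine h2.congr fun n => ?_
  simp [ENNReal.toReal_ofReal (hZ0 n ω)]

lemma tendsto_succ_pow_five_le {a : ℝ} (ha : 1 < a) :
    ∀ᶠ n : ℕ in atTop, (((n + 1) ^ 5 : ℕ) : ℝ) ≤ a * ((n ^ 5 : ℕ) : ℝ) := by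
  have h1 : Tendsto (fun n : ℕ => (1 + 1 / (n : ℝ)) ^ 5) atTop (𝓝 ((1 + 0) ^ 5)) :=
    (tendsto_const_nhds.add tendsto_one_div_atTop_nhds_zero_nat).pow 5
  rw [add_zero, one_pow] at h1
  filter_upwards [h1.eventually_le_const ha, eventually_gt_atTop 0] with n hn hn0
  have hn0' : (0 : ℝ) < n := by exact_mod_cast hn0
  push_cast
  calc ((n : ℝ) + 1) ^ 5 = (1 + 1 / (n : ℝ)) ^ 5 * (n : ℝ) ^ 5 := by
        rw [← mul_pow]
        congr 1
        field_simp
    _ ≤ a * (n : ℝ) ^ 5 := by gcongr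

/-- A strong law of large numbers for bounded nonnegative variables, from a bound on the variances
of the partial sums along fifth powers. -/
lemma ae_tendsto_average [IsProbabilityMeasure P] {Y : ℕ → Ω → ℝ} (hm : ∀ n, Measurable (Y n))
    (h0 : ∀ n ω, 0 ≤ Y n ω) (h1 : ∀ n ω, Y n ω ≤ 1) {l : ℝ}
    (hE : Tendsto (fun n => ∫ ω, Y n ω ∂P) atTop (𝓝 l)) {C : ℝ}
    (hV : ∀ n, 1 ≤ n → Var[fun ω => ∑ m ∈ Finset.range (n ^ 5), Y m ω; P] ≤ C * (n : ℝ) ^ 7) :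
    ∀ᵐ ω ∂P, Tendsto (fun t : ℕ => (1 / (t : ℝ)) * ∑ m ∈ Finset.range t, Y m ω) atTop (𝓝 l) := by
  have hL : ∀ n, MemLp (Y n) 2 P := fun n =>
    MemLp.of_bound (hm n).aestronglyMeasurable 1 (ae_of_all _ fun ω => by
      rw [Real.norm_eq_abs, abs_of_nonneg (h0 n ω)]
      exact h1 n ω)
  have hLS : ∀ n : ℕ, MemLp (fun ω => ∑ m ∈ Finset.range n, Y m ω) 2 P :=
    fun n => memLp_finsetSum _ fun i _ => hL i
  have hZae := ae_tendsto_zero_of_summable_integral (P := P)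
    (Z := fun n ω => ((∑ m ∈ Finset.range (n ^ 5), Y m ω -
      ∫ ω, ∑ m ∈ Finset.range (n ^ 5), Y m ω ∂P) / ((n ^ 5 : ℕ) : ℝ)) ^ 2)
    (b := fun n => C * (1 / (n : ℝ) ^ 3)) (fun n ω => sq_nonneg _) (fun n => ?_)
    ((Real.summable_one_div_nat_pow.2 (by norm_num)).mul_left C) (fun n => ?_)
  · have hEc : Tendsto (fun n : ℕ => (∫ ω, ∑ m ∈ Finset.range (n ^ 5), Y m ω ∂P) /
        ((n ^ 5 : ℕ) : ℝ)) atTop (𝓝 l) := by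
      have h2 := hE.cesaro.comp (tendsto_pow_atTop (by norm_num : (5 : ℕ) ≠ 0))
      refine h2.congr fun n => ?_
      simp only [Function.comp]
      rw [integral_finsetSum _ fun i _ => (hL i).integrable (by norm_num), div_eq_inv_mul]
    filter_upwards [hZae] with ω hω
    have h3 : Tendsto (fun n : ℕ => (∑ m ∈ Finset.range (n ^ 5), Y m ω) / ((n ^ 5 : ℕ) : ℝ))
        atTop (𝓝 l) := by
      have h4 := hω.sqrt
      simp only [Real.sqrt_sq_eq_abs, Real.sqrt_zero] at h4
      have h5 := ((tendsto_zero_iff_abs_tendsto_zero _).2 h4).add hEc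
      rw [zero_add] at h5
      refine h5.congr fun n => ?_
      ring
    -- The partial sums are monotone and consecutive fifth powers have ratio tending to `1`, so the
    -- subsequence decides the limit.
    have h6 := tendsto_div_of_monotone_of_exists_subseq_tendsto_div
      (fun t => ∑ m ∈ Finset.range t, Y m ω) l
      (fun a b hab => Finset.sum_le_sum_of_subset_of_nonneg (Finset.range_mono hab)
        fun i _ _ => h0 i ω)
      (fun a ha => ⟨fun n => n ^ 5, tendsto_succ_pow_five_le ha,
        tendsto_pow_atTop (by norm_num), h3⟩)
    refine h6.congr fun n => ?_
    rw [div_eq_inv_mul, one_div]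
  · simp only [div_pow]
    exact (((hLS _).sub (memLp_const _)).integrable_sq).div_const _
  · simp only [div_pow]
    rw [integral_div, ← variance_eq_integral (hLS _).aestronglyMeasurable.aemeasurable]
    rcases Nat.eq_zero_or_pos n with rfl | hn
    · simp
    have hn' : (0 : ℝ) < n := by exact_mod_cast hn
    rw [div_le_iff₀ (by positivity)]
    refine (hV n hn).trans (le_of_eq ?_)
    push_cast
    field_simp

/-- The variance of a partial sum, bounded through the decay of correlations. -/
lemma variance_sum_range_le [IsProbabilityMeasure P] {Y : ℕ → Ω → ℝ} (hL : ∀ n, MemLp (Y n) 2 P)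
    {t : ℕ} {b : ℕ → ℝ} (hb0 : ∀ j, 0 ≤ b j)
    (hb : ∀ m j, m + j < t → |cov[Y m, Y (m + j); P]| ≤ b j) :
    Var[fun ω => ∑ m ∈ Finset.range t, Y m ω; P] ≤ 2 * t * ∑ j ∈ Finset.range t, b j := by
  rw [variance_fun_sum' fun i _ => hL i]
  -- Pairs are sorted by lag in both directions; the diagonal is counted twice, harmlessly.
  have hpair : ∀ i ∈ Finset.range t, ∀ j ∈ Finset.range t,
      cov[Y i, Y j; P] ≤ (if i ≤ j then b (j - i) else 0) + if j ≤ i then b (i - j) else 0 := by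
    intro i hi j hj
    rw [Finset.mem_range] at hi hj
    have h1 : (0 : ℝ) ≤ if i ≤ j then b (j - i) else 0 := by
      split_ifs
      exacts [hb0 _, le_rfl]
    have h2 : (0 : ℝ) ≤ if j ≤ i then b (i - j) else 0 := by
      split_ifs
      exacts [hb0 _, le_rfl]
    rcases le_total i j with h | h
    · have := hb i (j - i) (by omega)
      rw [show i + (j - i) = j by omega] at this
      rw [if_pos h]
      linarith [le_abs_self (cov[Y i, Y j; P])]
    · have := hb j (i - j) (by omega)
      rw [show j + (i - j) = i by omega, covariance_comm] at this
      rw [if_pos h]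
      linarith [le_abs_self (cov[Y i, Y j; P])]
  have hrow : ∀ i ∈ Finset.range t,
      ∑ j ∈ Finset.range t, ((if i ≤ j then b (j - i) else 0) + if j ≤ i then b (i - j) else 0) ≤
        2 * ∑ j ∈ Finset.range t, b j := by
    intro i hi
    rw [Finset.mem_range] at hi
    have e1 : (Finset.range t).filter (fun j => i ≤ j) = Finset.Ico i t := by
      ext j
      simp [and_comm]
    have e2 : (Finset.range t).filter (fun j => j ≤ i) = Finset.range (i + 1) := by
      ext j
      simp only [Finset.mem_filter, Finset.mem_range]
      omega
    have hsub : ∀ u ≤ t, ∑ j ∈ Finset.range u, b j ≤ ∑ j ∈ Finset.range t, b j := fun u hu =>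
      Finset.sum_le_sum_of_subset_of_nonneg (Finset.range_mono hu) fun j _ _ => hb0 j
    rw [Finset.sum_add_distrib, ← Finset.sum_filter, ← Finset.sum_filter, e1, e2,
      Finset.sum_Ico_eq_sum_range]
    have h1 : ∑ j ∈ Finset.range (t - i), b (i + j - i) = ∑ j ∈ Finset.range (t - i), b j := by
      simp
    have h2 : ∑ j ∈ Finset.range (i + 1), b (i - j) = ∑ j ∈ Finset.range (i + 1), b j :=
      Finset.sum_range_reflect b (i + 1)
    rw [h1, h2]
    linarith [hsub (t - i) (by omega), hsub (i + 1) (by omega)]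
  calc _ ≤ ∑ i ∈ Finset.range t, 2 * ∑ j ∈ Finset.range t, b j :=
        Finset.sum_le_sum fun i hi => (Finset.sum_le_sum fun j hj => hpair i hi j hj).trans
          (hrow i hi)
    _ = _ := by
        rw [Finset.sum_const, Finset.card_range, nsmul_eq_mul]
        ring

end Averages

/-- Exchange factors one at a time. This bounds a covariance of the product by those of the
coordinates. -/
lemma abs_prod_sub_prod_le {ι : Type*} (s : Finset ι) {a b : ι → ℝ} (ha0 : ∀ i, 0 ≤ a i)
    (ha1 : ∀ i, a i ≤ 1) (hb0 : ∀ i, 0 ≤ b i) (hb1 : ∀ i, b i ≤ 1) :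
    |∏ i ∈ s, a i - ∏ i ∈ s, b i| ≤ ∑ i ∈ s, |a i - b i| := by
  classical
  induction s using Finset.induction_on with
  | empty => simp
  | insert i s hi ih =>
    rw [Finset.prod_insert hi, Finset.prod_insert hi, Finset.sum_insert hi]
    have hA : |∏ i ∈ s, a i| ≤ 1 := by
      rw [abs_of_nonneg (Finset.prod_nonneg fun i _ => ha0 i)]
      exact Finset.prod_le_one (fun i _ => ha0 i) fun i _ => ha1 i
    have hB : |b i| ≤ 1 := by rw [abs_of_nonneg (hb0 i)]; exact hb1 i
    calc |a i * ∏ i ∈ s, a i - b i * ∏ i ∈ s, b i|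
        = |(a i - b i) * ∏ i ∈ s, a i + b i * (∏ i ∈ s, a i - ∏ i ∈ s, b i)| := by ring_nf
      _ ≤ |a i - b i| * |∏ i ∈ s, a i| + |b i| * |∏ i ∈ s, a i - ∏ i ∈ s, b i| := by
          rw [← abs_mul, ← abs_mul]; exact abs_add_le _ _
      _ ≤ |a i - b i| * 1 + 1 * |∏ i ∈ s, a i - ∏ i ∈ s, b i| := by gcongr
      _ ≤ _ := by linarith

/-! ### Independent factors. -/

section Product

variable {r : ℕ} {S : Fin r → Type*} [∀ h, MeasurableSpace (S h)]
  {Ω : Type*} [MeasurableSpace Ω] {P : Measure Ω} {X : ∀ h, ℕ → Ω → S h}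

/-- Stated for events of whole trajectories, so that two-time events factorise too. -/
lemma measureReal_forall_mem_eq_prod (hindep : iIndepFun (fun h (ω : Ω) (t : ℕ) => X h t ω) P)
    {B : ∀ h, Set (ℕ → S h)} (hB : ∀ h, MeasurableSet (B h)) :
    P.real {ω | ∀ h, (fun t => X h t ω) ∈ B h} = ∏ h, P.real {ω | (fun t => X h t ω) ∈ B h} := by
  have h := hindep.meas_iInter (s := fun h => {ω | (fun t => X h t ω) ∈ B h})
    fun h => ⟨B h, hB h, rfl⟩
  simp only [measureReal_def, ← ENNReal.toReal_prod, ← h]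
  congr 2
  ext ω
  simp

variable [IsProbabilityMeasure P] [∀ h, MeasurableSingletonClass (S h)]

/-- Averages of the occupation indicators of a product of independent processes. -/
lemma ae_tendsto_average_prod (hX : ∀ h t, Measurable (X h t))
    (hindep : iIndepFun (fun h (ω : Ω) (t : ℕ) => X h t ω) P) (s : ∀ h, S h) {l : Fin r → ℝ}
    (hl : ∀ h, Tendsto (fun m => P.real {ω | X h m ω = s h}) atTop (𝓝 (l h)))
    (hcor : ∀ h, ∃ C : ℝ, ∀ n : ℕ, 1 ≤ n → ∃ b : ℕ → ℝ, (∀ j, 0 ≤ b j) ∧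
      (∀ m j, m + j < n ^ 5 → |P.real {ω | X h m ω = s h ∧ X h (m + j) ω = s h} -
        P.real {ω | X h m ω = s h} * P.real {ω | X h (m + j) ω = s h}| ≤ b j) ∧
      ∑ j ∈ Finset.range (n ^ 5), b j ≤ C * (n : ℝ) ^ 2) :
    ∀ᵐ ω ∂P, Tendsto (fun t : ℕ => (1 / (t : ℝ)) * ∑ m ∈ Finset.range t,
      ∏ h, Set.indicator {s h} (fun _ => (1 : ℝ)) (X h m ω)) atTop (𝓝 (∏ h, l h)) := by
  classical
  set Y : ℕ → Ω → ℝ := fun m ω => ∏ h, Set.indicator {s h} (fun _ => (1 : ℝ)) (X h m ω) with hY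
  set A : ℕ → Set Ω := fun m => {ω | ∀ h, X h m ω = s h} with hA
  have hAm : ∀ m, MeasurableSet (A m) := fun m => by
    rw [hA]
    simp only [Set.ofPred_forall]
    exact MeasurableSet.iInter fun h => hX h m (measurableSet_singleton (s h))
  have hYA : ∀ m, Y m = (A m).indicator 1 := by
    intro m
    funext ω
    by_cases hω : ω ∈ A m
    · rw [Set.indicator_of_mem hω]
      exact Finset.prod_eq_one fun h _ => by simp [show X h m ω = s h from hω h]
    · rw [Set.indicator_of_notMem hω]
      have : ∃ h, X h m ω ≠ s h := not_forall.1 hω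
      obtain ⟨h, hh⟩ := this
      exact Finset.prod_eq_zero (Finset.mem_univ h) (by simp [hh])
  have hYm : ∀ m, Measurable (Y m) := fun m => by
    rw [hYA]
    exact measurable_one.indicator (hAm m)
  have hY0 : ∀ m ω, 0 ≤ Y m ω := fun m ω => by
    rw [hYA]
    exact Set.indicator_nonneg (fun _ _ => zero_le_one) ω
  have hY1 : ∀ m ω, Y m ω ≤ 1 := fun m ω => by
    rw [hYA]
    exact Set.indicator_le_self' (fun _ _ => zero_le_one) ω
  have hL : ∀ n, MemLp (Y n) 2 P := fun n =>
    MemLp.of_bound (hYm n).aestronglyMeasurable 1 (ae_of_all _ fun ω => by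
      rw [Real.norm_eq_abs, abs_of_nonneg (hY0 n ω)]
      exact hY1 n ω)
  have hcoord : ∀ h m, MeasurableSet {x : ℕ → S h | x m = s h} := fun h m =>
    (measurable_pi_apply (X := fun _ : ℕ => S h) m) (measurableSet_singleton (s h))
  have hEY : ∀ m, ∫ ω, Y m ω ∂P = ∏ h, P.real {ω | X h m ω = s h} := by
    intro m
    rw [hYA, integral_indicator_one (hAm m)]
    exact measureReal_forall_mem_eq_prod hindep (B := fun h => {x | x m = s h})
      fun h => hcoord h m
  have hEYY : ∀ m n, ∫ ω, (Y m * Y n) ω ∂P =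
      ∏ h, P.real {ω | X h m ω = s h ∧ X h n ω = s h} := by
    intro m n
    have hmul : Y m * Y n = (A m ∩ A n).indicator 1 := by
      rw [hYA, hYA, Set.inter_indicator_one]
    rw [hmul, integral_indicator_one ((hAm m).inter (hAm n))]
    refine Eq.trans ?_ (measureReal_forall_mem_eq_prod hindep
      (B := fun h => {x | x m = s h ∧ x n = s h}) fun h => (hcoord h m).inter (hcoord h n))
    congr 1
    ext ω
    simp only [hA, Set.mem_inter_iff, Set.mem_ofPred_eq, forall_and]
  choose C hC using hcor
  refine ae_tendsto_average hYm hY0 hY1 (C := 2 * ∑ h, C h) ?_ fun n hn => ?_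
  · simp only [hEY]
    exact tendsto_finsetProd _ fun h _ => hl h
  choose b hb0 hb hbs using fun h => hC h n hn
  refine (variance_sum_range_le hL (t := n ^ 5) (b := fun j => ∑ h, b h j)
    (fun j => Finset.sum_nonneg fun h _ => hb0 h j) fun m j hmj => ?_).trans ?_
  · rw [covariance_eq_sub (hL _) (hL _), hEYY, hEY, hEY, ← Finset.prod_mul_distrib]
    refine (abs_prod_sub_prod_le _ (fun h => measureReal_nonneg) (fun h => measureReal_le_one)
      (fun h => mul_nonneg measureReal_nonneg measureReal_nonneg)
      (fun h => mul_le_one₀ measureReal_le_one measureReal_nonneg measureReal_le_one)).trans ?_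
    exact Finset.sum_le_sum fun h _ => hb h m j hmj
  · rw [Finset.sum_comm]
    have h1 : ∑ h, ∑ j ∈ Finset.range (n ^ 5), b h j ≤ (∑ h, C h) * (n : ℝ) ^ 2 := by
      rw [Finset.sum_mul]
      exact Finset.sum_le_sum fun h _ => hbs h
    calc _ ≤ 2 * ((n ^ 5 : ℕ) : ℝ) * ((∑ h, C h) * (n : ℝ) ^ 2) := by gcongr
      _ = _ := by push_cast; ring

end Product

/-- Each forbidden pair of successive states has probability zero, and there are finitely many
pairs. -/
lemma IsMarkovChain.isConsistent {Ω S : Type*} [MeasurableSpace Ω] [Fintype S]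
    [MeasurableSpace S] [MeasurableSingletonClass S] {P : Measure Ω} [IsProbabilityMeasure P]
    {init : S → ℝ} {Q : ℕ → Matrix S S ℝ} {X : ℕ → Ω → S} (hX : IsMarkovChain P init Q X)
    {G : SimpleGraph S} (hQ : ∀ t i j, Q t i j ≠ 0 → i = j ∨ G.Adj i j) :
    IsConsistent P G X := by
  classical
  intro t
  have h : ∀ i j, ¬ (i = j ∨ G.Adj i j) → ∀ᵐ ω ∂P, ¬ (X t ω = i ∧ X (t + 1) ω = j) := by
    intro i j hij
    have h0 : Q t i j = 0 := by
      by_contra h0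
      exact hij (hQ t i j h0)
    have h1 := hX.law_pair t 1 i j
    rw [transProd_succ, transProd, Matrix.mul_one, h0, mul_zero, measureReal_eq_zero_iff] at h1
    rw [ae_iff]
    simpa using h1
  have h' : ∀ᵐ ω ∂P, ∀ i j, ¬ (i = j ∨ G.Adj i j) → ¬ (X t ω = i ∧ X (t + 1) ω = j) :=
    ae_all_iff.2 fun i => ae_all_iff.2 fun j => by
      by_cases hij : i = j ∨ G.Adj i j
      · exact ae_of_all _ fun ω hn => absurd hij hn
      · filter_upwards [h i j hij] with ω hω _ using hω
  filter_upwards [h'] with ω hω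
  by_contra hn
  exact hω _ _ hn ⟨rfl, rfl⟩

lemma isConsistent_productProcess {ι Ω : Type*} [Countable ι] {S : ι → Type*} [MeasurableSpace Ω]
    {P : Measure Ω} {G : ∀ h, SimpleGraph (S h)} {X : ∀ h, ℕ → Ω → S h}
    (hX : ∀ h, IsConsistent P (G h) (X h)) :
    IsConsistent P (strongProduct G) (productProcess X) := by
  intro t
  filter_upwards [ae_all_iff.2 fun h => hX h t] with ω hω
  by_cases heq : productProcess X t ω = productProcess X (t + 1) ω
  · exact Or.inl heq
  · exact Or.inr ⟨heq, hω⟩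

end GraphChain

theorem theorem2p6 {r : ℕ} {S : Fin r → Type*} [∀ h, Fintype (S h)]
    [∀ h, MeasurableSpace (S h)] [∀ h, MeasurableSingletonClass (S h)]
    -- the factors: connected graphs and distributions vanishing somewhere
    (G : ∀ h, SimpleGraph (S h)) (hG : ∀ h, (G h).Connected)
    (μ : ∀ h, S h → ℝ) (hμ : ∀ h, μ h ∈ stdSimplex ℝ (S h))
    (hμ_zero : ∀ h, ∃ s, μ h s = 0)
    (e : ∀ h, S h ≃ Fin (Fintype.card (S h))) (he : ∀ h, GraphChain.IsLabelling (μ h) (e h))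
    -- the sequences of times
    (T : Fin r → ℕ → ℕ) (hT : ∀ h, StrictMonoOn (T h) (Set.Ici 1))
    (c : ℝ) (hc : 0 < c)
    (hgap : ∀ h, ∀ l : ℕ, 1 ≤ l →
      c * (l : ℝ) ^ (5 * Fintype.card (S h) - 1) ≤ (T h (l + 1) : ℝ) - (T h l : ℝ))
    -- the transition matrices, prescribed from the block with index `k₀ h` on
    (k₀ : Fin r → ℕ) (hk₀ : ∀ h, 1 ≤ k₀ h)
    (Q : ∀ h, ℕ → Matrix (S h) (S h) ℝ)
    (hQ : ∀ h, ∀ k, k₀ h ≤ k → ∀ t, T h k ≤ t → t < T h (k + 1) →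
      Q h t = GraphChain.transMatrix (GraphChain.perturbed (μ h) k) (G h) (e h))
    -- the independent chains
    {Ω : Type*} [MeasurableSpace Ω] (P : Measure Ω) [IsProbabilityMeasure P]
    (init : ∀ h, S h → ℝ) (X : ∀ h, ℕ → Ω → S h)
    (hX : ∀ h, GraphChain.IsMarkovChain P (init h) (Q h) (X h))
    (hindep : iIndepFun (fun h (ω : Ω) (t : ℕ) => X h t ω) P) :
    (∀ᵐ ω ∂P, ∀ s : (∀ h, S h),
      Tendsto (fun t : ℕ => (1 / (t : ℝ)) * ∑ m ∈ Finset.range t,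
          Set.indicator {s} (fun _ => (1 : ℝ)) (GraphChain.productProcess X m ω))
        atTop (𝓝 (∏ h, μ h (s h))) ∧
      Tendsto (fun t : ℕ => (1 / (t : ℝ)) * ∑ m ∈ Finset.range t,
          ∏ h, Set.indicator {s h} (fun _ => (1 : ℝ)) (X h m ω))
        atTop (𝓝 (∏ h, μ h (s h)))) ∧
    ((∀ h, ∀ t < T h (k₀ h), ∀ i j, Q h t i j ≠ 0 → i = j ∨ (G h).Adj i j) →
      GraphChain.IsConsistent P (GraphChain.strongProduct G) (GraphChain.productProcess X)) := by
  refine ⟨?_, fun hQ₀ => ?_⟩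
  · have key : ∀ s : (∀ h, S h), ∀ᵐ ω ∂P, Tendsto (fun t : ℕ => (1 / (t : ℝ)) *
        ∑ m ∈ Finset.range t, ∏ h, Set.indicator {s h} (fun _ => (1 : ℝ)) (X h m ω))
        atTop (𝓝 (∏ h, μ h (s h))) := fun s =>
      GraphChain.ae_tendsto_average_prod (fun h => (hX h).measurable) hindep s
        (fun h => GraphChain.tendsto_law (hG h) (hμ h) (hμ_zero h) (hT h) hc (hgap h) (hQ h)
          (hX h) (s h))
        (fun h => GraphChain.exists_correlation_bound (hG h) (hμ h) (hμ_zero h) (hT h) hc (hgap h)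
          (hQ h) (hX h) (s h))
    -- The product state space is finite, so one null set serves all `s`.
    filter_upwards [ae_all_iff.2 key] with ω hω s
    refine ⟨(hω s).congr fun t => ?_, hω s⟩
    congr 1
    refine Finset.sum_congr rfl fun m _ => ?_
    by_cases h : GraphChain.productProcess X m ω = s
    · rw [Set.indicator_of_mem (Set.mem_singleton_iff.2 h)]
      subst h
      exact Finset.prod_eq_one fun i _ => Set.indicator_of_mem (Set.mem_singleton _) _
    · rw [Set.indicator_of_notMem (fun hm => h (Set.mem_singleton_iff.1 hm))]
      obtain ⟨i, hi⟩ := Function.ne_iff.1 h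
      exact Finset.prod_eq_zero (Finset.mem_univ i)
        (Set.indicator_of_notMem (fun hm => hi (Set.mem_singleton_iff.1 hm)) _)
  · refine GraphChain.isConsistent_productProcess fun h => (hX h).isConsistent fun t i j hij => ?_
    rcases lt_or_ge t (T h (k₀ h)) with ht | ht
    · exact hQ₀ h t ht i j hij
    · obtain ⟨k, hk, hk1, hk2⟩ := GraphChain.exists_block (hT h) (hk₀ h) ht
      rw [hQ h k hk t hk1 hk2] at hij
      by_contra hn
      exact hij (GraphChain.transMatrix_eq_zero hn)
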